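/- Let $p=(p_1,p_2)$ be coprime positive integers, $R=p_1x\,\partial_x+p_2y\,\partial_y$, and let $h\in\mathbb C[x,y]$ be quasi-homogeneous of weights $p$ and degree $\delta$ (i.e. $R(h)=\delta h$), with an isolated singularity at the origin. Put $X_0=\delta^{-1}(h_y\,\partial_x-h_x\,\partial_y)$, which is quasi-homogeneous of degree $\delta_0=\delta-p_1-p_2$ (the monomial field $x^my^n\partial_x$ has degree $p_1m+p_2n-p_1$, and $x^my^n\partial_y$ has degree $p_1m+p_2n-p_2$). Let $J_0=(h_x,h_y)\subset\mathbb C[[x,y]]$ be the ideal generated by the components of $X_0$, and let $a_1,\dots,a_\mu$ be quasi-homogeneous polynomials (for instance monomials) whose classes form a basis of the complex vector space $\mathbb C[[x,y]]/J_0$. Let $X$ be a formal vector field at the origin of $\mathbb C^2$ such that all the quasi-homogeneous components of $X-X_0$ have degree $>\delta_0$ and such that $X$ is tangent to the separatrices $\{h=0\}$ of $X_0$, i.e. $X(h)\in(h)$. Then there exist formal series in one variable $d_1,\dots,d_\mu\in\mathbb C[[t]]$, a formal diffeomorphism $\Phi$ of $(\mathbb C^2,0)$ and a formal unit $u\in\mathbb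 C[[x,y]]$, $u(0)\neq0$, such that $$\Phi^*X=u\Big(X_0+\sum_{i=1}^{\mu}d_i(h)\,a_i\,R\Big),$$ so that $X$ is formally orbitally equivalent to $X_0+\sum_i d_i(h)a_iR$. Moreover $\Phi$ can be chosen fibred with respect to $R$: $\Phi=\exp(bR)$ for some $b\in\mathbb C[[x,y]]$ with $b(0)=0$, that is, $f\circ\Phi=\sum_{n\ge0}\frac1{n!}(bR)^n(f)$ for all $f\in\mathbb C[[x,y]]$. -/

import Mathlib

open scoped Topology Nat

noncomputable section

namespace QHFoliation

/-- The ring `ℂ⟦x, y⟧` of formal power series in two variables (`x = X 0`, `y = X 1`). -/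
abbrev FormalSeries : Type := MvPowerSeries (Fin 2) ℂ

/-- Formal vector fields on `(ℂ², 0)`, seen as `ℂ`-derivations of `ℂ⟦x, y⟧`; the component of
`V` along `∂ᵢ` is the series `V (X i)`. -/
abbrev FormalField : Type := Derivation ℂ FormalSeries FormalSeries

/-- The `p`-radial field `R = p₁ x ∂ₓ + p₂ y ∂_y`. -/
def radial (p : Fin 2 → ℕ) : FormalField :=
  ∑ i, ((p i : FormalSeries) * MvPowerSeries.X i) • MvPowerSeries.pderiv ℂ i

/-- The Hamiltonian field `X_f = f_y ∂ₓ - f_x ∂_y`. -/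
def hamiltonian (f : FormalSeries) : FormalField :=
  MvPowerSeries.pderiv ℂ 1 f • MvPowerSeries.pderiv ℂ 0
    - MvPowerSeries.pderiv ℂ 0 f • MvPowerSeries.pderiv ℂ 1

/-- The initial field `X₀ = δ⁻¹ X_h`. -/
def initialField (h : MvPolynomial (Fin 2) ℂ) (δ : ℕ) : FormalField :=
  (δ : ℂ)⁻¹ • hamiltonian (h : FormalSeries)

/-- The ideal of `ℂ⟦x, y⟧` generated by the components of a field. -/
def componentIdeal (V : FormalField) : Ideal FormalSeries :=
  Ideal.span (Set.range fun i : Fin 2 => V (MvPowerSeries.X i))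

/-- All quasi-homogeneous components of `V` have degree greater than `k`; the monomial field
`x^m ∂ᵢ` has degree `⟨p, m⟩ - pᵢ`. -/
def OrderGT (p : Fin 2 → ℕ) (k : ℤ) (V : FormalField) : Prop :=
  ∀ (i : Fin 2) (m : Fin 2 →₀ ℕ), MvPowerSeries.coeff m (V (MvPowerSeries.X i)) ≠ 0 →
    k < (Finsupp.weight p m : ℤ) - (p i : ℤ)

/-- `V` is tangent to the curve `g = 0` (`g` a reduced equation): `V(g)` belongs to `(g)`. -/
def IsLogarithmic (g : FormalSeries) (V : FormalField) : Prop :=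
  V g ∈ Ideal.span {g}

/-- The polynomial function `h` on `ℂ²` has an isolated singularity at the origin: the origin is
a critical point, and it is isolated among the critical points. -/
def HasIsolatedSingularity (h : MvPolynomial (Fin 2) ℂ) : Prop :=
  (∀ i, MvPolynomial.eval 0 (MvPolynomial.pderiv i h) = 0) ∧
    ∀ᶠ z : Fin 2 → ℂ in 𝓝[≠] 0, ∃ i, MvPolynomial.eval z (MvPolynomial.pderiv i h) ≠ 0

/-- Formal diffeomorphisms `Φ` of `(ℂ², 0)`, given by their action `f ↦ f ∘ Φ` on `ℂ⟦x, y⟧`.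
(The `ℂ`-algebra automorphisms of `ℂ⟦x, y⟧` are exactly the substitutions of a pair of series
vanishing at the origin and with invertible linear part.) -/
abbrev FormalDiffeo : Type := FormalSeries ≃ₐ[ℂ] FormalSeries

/-- The pull-back `Φ^* V`, characterised by `(Φ^* V)(f ∘ Φ) = V(f) ∘ Φ`. -/
def pullback (Φ : FormalDiffeo) (V : FormalField) : FormalField :=
  Derivation.mk' (Φ.toLinearMap ∘ₗ (V : FormalSeries →ₗ[ℂ] FormalSeries) ∘ₗ Φ.symm.toLinearMap)
    (fun f g => by simp)

/-- `Φ` is the exponential of `Z`: `f ∘ Φ = ∑ₙ Zⁿ(f) / n!` for every `f`, the series being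
summed coefficient by coefficient. -/
def IsExp (Z : FormalField) (Φ : FormalDiffeo) : Prop :=
  ∀ (f : FormalSeries) (m : Fin 2 →₀ ℕ),
    HasSum (fun n : ℕ => (n ! : ℂ)⁻¹ * MvPowerSeries.coeff m (Z^[n] f))
      (MvPowerSeries.coeff m (Φ f))

/-- `Φ` is fibred with respect to `R`: it is the exponential of a field `b R`, where the series
`b` has no constant term (so that each coefficient of the exponential is a finite sum). -/
def IsFibred (p : Fin 2 → ℕ) (Φ : FormalDiffeo) : Prop :=
  ∃ b : FormalSeries, MvPowerSeries.constantCoeff b = 0 ∧ IsExp (b • radial p) Φ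

end QHFoliation

end

/-!
Write `δ₀ = δ - p₁ - p₂`, and filter `ℂ⟦x, y⟧` by quasi-homogeneous order (`filt`), for which it is
separated and complete (`eq_zero_of_forall_mem_filt`, `exists_limit`).

*Division.* Since `ℂ⟦x, y⟧ / (h_x, h_y)` is finite-dimensional, the Jacobian ideal contains powers
of `x` and of `y`, so `h_x` and `h_y` have only the trivial relations. If `X(h) = g h`, the field
`X - δ⁻¹ g R` kills `h`, hence it is a multiple of `X₀`. This gives `X = u' (X₀ + f R)` with
`u' = 1 + ⋯` and `f` of order greater than `δ₀` (`exists_logarithmic_form`).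

*Conjugation.* As `[R, X₀] = δ₀ X₀`, the fields `A X₀ + C R` are stable under the bracket with
`b R`, so `exp(bR)` transforms `X₀ + f R` into some `A X₀ + C R` with `A = 1 + ⋯` and
`C = f - X₀(b) + ⋯`, where the omitted terms of degree `δ₀ + j` only involve the components of `b`
of degree less than `j` (`exists_conjugation`).

*Homological equation.* Every series is `X₀(τ) + ∑ dᵢ(h) aᵢ`: modulo the `aᵢ` it is an element
`α h_x + β h_y` of the Jacobian ideal, and Cartan's formula for the form `α dy - β dx` turns this
into an element of the image of `X₀` plus `h` times a series of lower degree
(`euler_identity`, `exists_homological`). This gives an operator `w ↦ T w` that lowers the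
order by `δ₀` and such that `w - X₀(T w)` has the form `∑ dᵢ(h) aᵢ`
(`exists_solution_operator`).

The required normal form is the equation `C = A (w - X₀(b))` with `b = T w`. It is the fixed point
equation of a map of `w` that strictly increases the order of differences, and so it has a solution
(`exists_fixedPoint`).
-/

noncomputable section

namespace QHFoliation

/-! ### The quasi-homogeneous filtration -/

/-- The quasi-homogeneous degree of the monomial of exponent `m`, as an integer (the degree
`δ - p₁ - p₂` of the initial field enters as a shift, and need not be nonnegative a priori). -/
def wt (p : Fin 2 → ℕ) (m : Fin 2 →₀ ℕ) : ℤ := (Finsupp.weight p m : ℕ)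

/-- The series all of whose monomials have quasi-homogeneous degree at least `k`. -/
def filt (p : Fin 2 → ℕ) (k : ℤ) : Submodule ℂ FormalSeries where
  carrier := {f | ∀ m, wt p m < k → MvPowerSeries.coeff m f = 0}
  add_mem' := fun {f g} hf hg m hm => by rw [map_add, hf m hm, hg m hm, add_zero]
  zero_mem' := fun m _ => map_zero _
  smul_mem' := fun c f hf m hm => by rw [MvPowerSeries.coeff_smul, hf m hm, mul_zero]

/-- The series that are quasi-homogeneous of degree `k`. -/
def homog (p : Fin 2 → ℕ) (k : ℤ) : Submodule ℂ FormalSeries where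
  carrier := {f | ∀ m, wt p m ≠ k → MvPowerSeries.coeff m f = 0}
  add_mem' := fun {f g} hf hg m hm => by rw [map_add, hf m hm, hg m hm, add_zero]
  zero_mem' := fun m _ => map_zero _
  smul_mem' := fun c f hf m hm => by rw [MvPowerSeries.coeff_smul, hf m hm, mul_zero]

/-- The quasi-homogeneous component of degree `k` of a series. -/
def comp (p : Fin 2 → ℕ) (k : ℤ) (f : FormalSeries) : FormalSeries :=
  fun m => if wt p m = k then MvPowerSeries.coeff m f else 0

variable {p : Fin 2 → ℕ}

lemma wt_add (m n : Fin 2 →₀ ℕ) : wt p (m + n) = wt p m + wt p n := by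
  simp [wt]

lemma wt_single (i : Fin 2) : wt p (Finsupp.single i 1) = p i := by
  simp [wt, Finsupp.weight_single]

lemma wt_nonneg (m : Fin 2 →₀ ℕ) : 0 ≤ wt p m := by
  simp [wt]

lemma coeff_comp (k : ℤ) (f : FormalSeries) (m : Fin 2 →₀ ℕ) :
    MvPowerSeries.coeff m (comp p k f) = if wt p m = k then MvPowerSeries.coeff m f else 0 :=
  rfl

lemma filt_anti {j k : ℤ} (hjk : j ≤ k) {f : FormalSeries} (hf : f ∈ filt p k) : f ∈ filt p j :=
  fun m hm => hf m (hm.trans_le hjk)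

lemma mem_filt_of_nonpos {k : ℤ} (hk : k ≤ 0) (f : FormalSeries) : f ∈ filt p k :=
  fun m hm => absurd (hm.trans_le hk) (not_lt.2 (wt_nonneg m))

lemma homog_le_filt {k : ℤ} {f : FormalSeries} (hf : f ∈ homog p k) : f ∈ filt p k :=
  fun m hm => hf m hm.ne

lemma homog_eq_zero_of_neg {k : ℤ} (hk : k < 0) {f : FormalSeries} (hf : f ∈ homog p k) :
    f = 0 := by
  ext m
  exact hf m (hk.trans_le (wt_nonneg m)).ne'

/-- The filtration is separated. -/
lemma eq_zero_of_forall_mem_filt {f : FormalSeries} (k : ℤ)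
    (hf : ∀ n : ℕ, f ∈ filt p (k + n)) : f = 0 := by
  ext m
  refine hf (wt p m + 1 - k).toNat m ?_
  have := Int.self_le_toNat (wt p m + 1 - k)
  linarith

lemma mul_mem_filt {j k : ℤ} {f g : FormalSeries} (hf : f ∈ filt p j) (hg : g ∈ filt p k) :
    f * g ∈ filt p (j + k) := by
  intro m hm
  rw [MvPowerSeries.coeff_mul]
  refine Finset.sum_eq_zero fun q hq => ?_
  rw [← Finset.HasAntidiagonal.mem_antidiagonal.1 hq, wt_add] at hm
  by_cases h : wt p q.1 < j
  · rw [hf _ h, zero_mul]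
  · rw [hg _ (by linarith), mul_zero]

lemma mul_mem_homog {j k : ℤ} {f g : FormalSeries} (hf : f ∈ homog p j) (hg : g ∈ homog p k) :
    f * g ∈ homog p (j + k) := by
  intro m hm
  rw [MvPowerSeries.coeff_mul]
  refine Finset.sum_eq_zero fun q hq => ?_
  rw [← Finset.HasAntidiagonal.mem_antidiagonal.1 hq, wt_add] at hm
  by_cases h : wt p q.1 = j
  · rw [hg _ (by rintro rfl; exact hm (by rw [h])), mul_zero]
  · rw [hf _ h, zero_mul]

lemma one_mem_homog : (1 : FormalSeries) ∈ homog p 0 := by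
  intro m hm
  rw [MvPowerSeries.coeff_one, if_neg]
  rintro rfl
  exact hm (by simp [wt])

lemma pow_mem_homog {k : ℤ} {f : FormalSeries} (hf : f ∈ homog p k) (n : ℕ) :
    f ^ n ∈ homog p (n * k) := by
  induction n with
  | zero => simpa using one_mem_homog
  | succ n ih =>
    rw [pow_succ]
    have := mul_mem_homog ih hf
    convert this using 2
    push_cast
    ring

lemma X_mem_homog (i : Fin 2) : (MvPowerSeries.X i : FormalSeries) ∈ homog p (p i) := by
  intro m hm
  rw [MvPowerSeries.coeff_X, if_neg]
  rintro rfl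
  exact hm (wt_single i)

lemma comp_mem (k : ℤ) (f : FormalSeries) : comp p k f ∈ homog p k := by
  intro m hm
  rw [coeff_comp, if_neg hm]

lemma comp_add (k : ℤ) (f g : FormalSeries) : comp p k (f + g) = comp p k f + comp p k g := by
  ext m
  simp only [coeff_comp, map_add]
  split_ifs <;> simp

lemma comp_sub (k : ℤ) (f g : FormalSeries) : comp p k (f - g) = comp p k f - comp p k g := by
  ext m
  simp only [coeff_comp, map_sub]
  split_ifs <;> simp

lemma comp_smul (k : ℤ) (c : ℂ) (f : FormalSeries) : comp p k (c • f) = c • comp p k f := by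
  ext m
  simp only [coeff_comp, MvPowerSeries.coeff_smul]
  split_ifs <;> simp

lemma comp_sum {ι : Type*} (s : Finset ι) (k : ℤ) (f : ι → FormalSeries) :
    comp p k (∑ i ∈ s, f i) = ∑ i ∈ s, comp p k (f i) := by
  ext m
  simp only [coeff_comp, map_sum]
  split_ifs <;> simp

lemma comp_self {k : ℤ} {f : FormalSeries} (hf : f ∈ homog p k) : comp p k f = f := by
  ext m
  rw [coeff_comp]
  split_ifs with h
  · rfl
  · exact (hf m h).symm

lemma comp_of_ne {j k : ℤ} (hjk : j ≠ k) {f : FormalSeries} (hf : f ∈ homog p j) :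
    comp p k f = 0 := by
  ext m
  rw [coeff_comp]
  split_ifs with h
  · exact hf m (by rintro rfl; exact hjk h)
  · rfl

lemma comp_eq_zero {j k : ℤ} (hjk : k < j) {f : FormalSeries} (hf : f ∈ filt p j) :
    comp p k f = 0 := by
  ext m
  rw [coeff_comp]
  split_ifs with h
  · exact hf m (h ▸ hjk)
  · rfl

lemma mem_filt_iff {k : ℤ} {f : FormalSeries} :
    f ∈ filt p k ↔ ∀ j < k, comp p j f = 0 := by
  refine ⟨fun hf j hj => comp_eq_zero hj hf, fun hf m hm => ?_⟩
  have := congrArg (MvPowerSeries.coeff m) (hf _ hm)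
  rwa [coeff_comp, if_pos rfl] at this

lemma ext_comp {f g : FormalSeries} (hfg : ∀ k, comp p k f = comp p k g) : f = g := by
  ext m
  have := congrArg (MvPowerSeries.coeff m) (hfg (wt p m))
  rwa [coeff_comp, coeff_comp, if_pos rfl, if_pos rfl] at this

/-- Multiplication by a quasi-homogeneous series of degree `j` shifts components by `j`. -/
lemma comp_mul {j : ℤ} (k : ℤ) {f g : FormalSeries} (hf : f ∈ homog p j) :
    comp p k (f * g) = f * comp p (k - j) g := by
  ext m
  rw [coeff_comp, MvPowerSeries.coeff_mul, MvPowerSeries.coeff_mul]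
  split_ifs with h
  · refine Finset.sum_congr rfl fun q hq => ?_
    by_cases h' : wt p q.1 = j
    · rw [coeff_comp, if_pos]
      rw [← Finset.HasAntidiagonal.mem_antidiagonal.1 hq, wt_add] at h
      linarith
    · rw [hf _ h', zero_mul, zero_mul]
  · refine (Finset.sum_eq_zero fun q hq => ?_).symm
    by_cases h' : wt p q.1 = j
    · rw [coeff_comp, if_neg, mul_zero]
      rw [← Finset.HasAntidiagonal.mem_antidiagonal.1 hq, wt_add] at h
      intro h''
      exact h (by linarith)
    · rw [hf _ h', zero_mul]

/-- Division by a nonzero quasi-homogeneous series is strict for the filtration. -/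
lemma mem_filt_of_mul_mem {j k : ℤ} {f g : FormalSeries} (hf : f ∈ homog p j) (hf0 : f ≠ 0)
    (hfg : f * g ∈ filt p (k + j)) : g ∈ filt p k := by
  rw [mem_filt_iff]
  intro l hl
  have h1 := mem_filt_iff.1 hfg (l + j) (by linarith)
  rw [comp_mul _ hf, add_sub_cancel_right] at h1
  exact (mul_eq_zero.1 h1).resolve_left hf0

lemma pderiv_mem_filt {k : ℤ} {f : FormalSeries} (hf : f ∈ filt p k) (i : Fin 2) :
    MvPowerSeries.pderiv ℂ i f ∈ filt p (k - p i) := by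
  intro m hm
  rw [MvPowerSeries.coeff_pderiv, hf, zero_mul]
  rw [wt_add, wt_single]
  linarith

lemma comp_pderiv (k : ℤ) (f : FormalSeries) (i : Fin 2) :
    comp p k (MvPowerSeries.pderiv ℂ i f) = MvPowerSeries.pderiv ℂ i (comp p (k + p i) f) := by
  ext m
  rw [coeff_comp, MvPowerSeries.coeff_pderiv, MvPowerSeries.coeff_pderiv, coeff_comp, wt_add,
    wt_single]
  by_cases h : wt p m = k
  · rw [if_pos h, if_pos (by rw [h])]
  · rw [if_neg h, if_neg (by intro h'; exact h (by linarith)), zero_mul]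

lemma pderiv_mem_homog {k : ℤ} {f : FormalSeries} (hf : f ∈ homog p k) (i : Fin 2) :
    MvPowerSeries.pderiv ℂ i f ∈ homog p (k - p i) := by
  intro m hm
  rw [MvPowerSeries.coeff_pderiv, hf, zero_mul]
  rw [wt_add, wt_single]
  intro h
  exact hm (by linarith)

/-- The filtration is complete: a sequence whose successive differences go to zero has a limit. -/
lemma exists_limit (k : ℤ) (s : ℕ → FormalSeries)
    (hs : ∀ n : ℕ, s (n + 1) - s n ∈ filt p (k + n)) :
    ∃ e, ∀ n : ℕ, e - s n ∈ filt p (k + n) := by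
  have key : ∀ n d : ℕ, s (n + d) - s n ∈ filt p (k + n) := by
    intro n d
    induction d with
    | zero => simp
    | succ d ih =>
      have h1 := filt_anti (j := k + n) (by push_cast; linarith) (hs (n + d))
      have := (filt p (k + n)).add_mem h1 ih
      rwa [sub_add_sub_cancel] at this
  let e : FormalSeries := fun m => MvPowerSeries.coeff m (s (wt p m + 1 - k).toNat)
  have he : ∀ m, MvPowerSeries.coeff m e =
    MvPowerSeries.coeff m (s (wt p m + 1 - k).toNat) := fun m => rfl
  refine ⟨e, fun n m hm => ?_⟩
  have h1 : (wt p m + 1 - k).toNat ≤ n := by omega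
  obtain ⟨d, rfl⟩ := Nat.exists_eq_add_of_le h1
  have h2 := key (wt p m + 1 - k).toNat d m (by
    have := Int.self_le_toNat (wt p m + 1 - k)
    linarith)
  rw [map_sub, sub_eq_zero] at h2
  rw [map_sub, he, sub_eq_zero]
  exact h2.symm

/-- A map of `filt p k` that strictly increases the order of differences has a fixed point. -/
lemma exists_fixedPoint (k : ℤ) (K : FormalSeries → FormalSeries)
    (hK0 : ∀ w ∈ filt p k, K w ∈ filt p k)
    (hK : ∀ w ∈ filt p k, ∀ w' ∈ filt p k, ∀ j : ℤ, k ≤ j → w - w' ∈ filt p j →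
      K w - K w' ∈ filt p (j + 1)) :
    ∃ w ∈ filt p k, K w = w := by
  set s : ℕ → FormalSeries := fun n => K^[n] 0 with hs
  have hsucc : ∀ n, s (n + 1) = K (s n) := fun n => Function.iterate_succ_apply' K n 0
  have hsF : ∀ n, s n ∈ filt p k := by
    intro n
    induction n with
    | zero => exact (filt p k).zero_mem
    | succ n ih => rw [hsucc]; exact hK0 _ ih
  have hd : ∀ n : ℕ, s (n + 1) - s n ∈ filt p (k + n) := by
    intro n
    induction n with
    | zero => simpa using (filt p k).sub_mem (hsF 1) (hsF 0)
    | succ n ih =>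
      have := hK _ (hsF (n + 1)) _ (hsF n) _ (by linarith) ih
      rw [← hsucc, ← hsucc, add_assoc] at this
      exact_mod_cast this
  obtain ⟨w, hw⟩ := exists_limit k s hd
  have hwF : w ∈ filt p k := by
    have := (filt p k).add_mem (filt_anti (by simp) (hw 0)) (hsF 0)
    rwa [sub_add_cancel] at this
  refine ⟨w, hwF, ?_⟩
  rw [← sub_eq_zero]
  refine eq_zero_of_forall_mem_filt (p := p) k fun n => ?_
  have h1 : K w - s (n + 1) ∈ filt p (k + n) := by
    rw [hsucc]
    exact filt_anti (by linarith) (hK _ hwF _ (hsF n) _ (by linarith) (hw n))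
  have h2 : w - s (n + 1) ∈ filt p (k + n) := filt_anti (by push_cast; linarith) (hw (n + 1))
  have := (filt p (k + n)).sub_mem h1 h2
  rwa [sub_sub_sub_cancel_right] at this

/-! ### Vector fields -/

/-- Every series splits as `c + x f₁ + y f₂`. -/
lemma exists_eq_C_add_X_mul (f : FormalSeries) :
    ∃ (c : ℂ) (f₁ f₂ : FormalSeries),
      f = MvPowerSeries.C c + MvPowerSeries.X 0 * f₁ + MvPowerSeries.X 1 * f₂ := by
  let g : FormalSeries := fun m => if m 0 = 0 then MvPowerSeries.coeff m f else 0
  have hg : ∀ m, MvPowerSeries.coeff m g = if m 0 = 0 then MvPowerSeries.coeff m f else 0 :=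
    fun m => rfl
  have h1 : (MvPowerSeries.X 0 : FormalSeries) ∣ f - g := by
    rw [MvPowerSeries.X_dvd_iff]
    intro m hm
    rw [map_sub, hg, if_pos hm, sub_self]
  have h2 : (MvPowerSeries.X 1 : FormalSeries) ∣
      g - MvPowerSeries.C (MvPowerSeries.coeff 0 f) := by
    rw [MvPowerSeries.X_dvd_iff]
    intro m hm
    rw [map_sub, hg, MvPowerSeries.coeff_C]
    by_cases h0 : m 0 = 0
    · have : m = 0 := by
        ext i
        fin_cases i
        · exact h0
        · exact hm
      subst this
      simp
    · rw [if_neg h0, if_neg (by rintro rfl; exact h0 rfl), sub_zero]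
  obtain ⟨f₁, h1⟩ := h1
  obtain ⟨f₂, h2⟩ := h2
  exact ⟨MvPowerSeries.coeff 0 f, f₁, f₂, by linear_combination h1 + h2⟩

/-- A derivation of `ℂ⟦x, y⟧` that kills the variables is zero; no continuity is assumed. -/
lemma field_eq_zero (V : FormalField) (hV : ∀ i, V (MvPowerSeries.X i) = 0) (f : FormalSeries) :
    V f = 0 := by
  have key : ∀ (n : ℕ) (f : FormalSeries), V f ∈ filt (fun _ => 1) (0 + n : ℤ) := by
    intro n
    induction n with
    | zero => intro f; exact mem_filt_of_nonpos (by simp) _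
    | succ n ih =>
      intro f
      obtain ⟨c, f₁, f₂, rfl⟩ := exists_eq_C_add_X_mul f
      have hc : V (MvPowerSeries.C c) = 0 := V.map_algebraMap c
      simp only [map_add, hc, zero_add, V.leibniz, hV, smul_eq_mul, mul_zero, add_zero]
      have h1 := mul_mem_filt (homog_le_filt (X_mem_homog (p := fun _ => 1) 0)) (ih f₁)
      have h2 := mul_mem_filt (homog_le_filt (X_mem_homog (p := fun _ => 1) 1)) (ih f₂)
      refine Submodule.add_mem _ (filt_anti ?_ h1) (filt_anti ?_ h2) <;> push_cast <;> linarith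
  exact eq_zero_of_forall_mem_filt 0 fun n => key n f

lemma field_apply (V : FormalField) (f : FormalSeries) :
    V f = V (MvPowerSeries.X 0) * MvPowerSeries.pderiv ℂ 0 f +
      V (MvPowerSeries.X 1) * MvPowerSeries.pderiv ℂ 1 f := by
  have := field_eq_zero (V - (V (MvPowerSeries.X 0) • MvPowerSeries.pderiv ℂ 0 +
      V (MvPowerSeries.X 1) • MvPowerSeries.pderiv ℂ 1)) (by
    intro i
    fin_cases i <;> simp) f
  simpa [sub_eq_zero] using this

lemma field_ext {V W : FormalField} (hVW : ∀ i, V (MvPowerSeries.X i) = W (MvPowerSeries.X i)) :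
    V = W := by
  ext1 f
  rw [field_apply V, field_apply W, hVW, hVW]

lemma radial_apply (f : FormalSeries) :
    radial p f = (p 0 : FormalSeries) * MvPowerSeries.X 0 * MvPowerSeries.pderiv ℂ 0 f +
      (p 1 : FormalSeries) * MvPowerSeries.X 1 * MvPowerSeries.pderiv ℂ 1 f := by
  simp [radial, Fin.sum_univ_two]

lemma radial_X (i : Fin 2) :
    radial p (MvPowerSeries.X i) = (p i : FormalSeries) * MvPowerSeries.X i := by
  fin_cases i <;> simp [radial_apply]

lemma coeff_X_mul_pderiv (i : Fin 2) (f : FormalSeries) (m : Fin 2 →₀ ℕ) :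
    MvPowerSeries.coeff m (MvPowerSeries.X i * MvPowerSeries.pderiv ℂ i f) =
      m i * MvPowerSeries.coeff m f := by
  rw [MvPowerSeries.X, MvPowerSeries.coeff_monomial_mul, one_mul]
  split_ifs with h
  · rw [MvPowerSeries.coeff_pderiv, tsub_add_cancel_of_le h, Finsupp.tsub_apply,
      Finsupp.single_eq_same]
    have : 1 ≤ m i := by simpa using h i
    push_cast [this]
    ring
  · have : m i = 0 := by
      by_contra h0
      exact h (Finsupp.single_le_iff.2 (Nat.one_le_iff_ne_zero.2 h0))
    simp [this]

/-- Euler's formula: `R` acts on monomials as multiplication by the quasi-homogeneous degree. -/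
lemma coeff_radial (f : FormalSeries) (m : Fin 2 →₀ ℕ) :
    MvPowerSeries.coeff m (radial p f) = (wt p m : ℂ) * MvPowerSeries.coeff m f := by
  have hc : ∀ i, (p i : FormalSeries) = MvPowerSeries.C (p i : ℂ) := fun i => by simp
  rw [radial_apply, map_add, mul_assoc, mul_assoc, hc, hc, MvPowerSeries.coeff_C_mul,
    MvPowerSeries.coeff_C_mul, coeff_X_mul_pderiv, coeff_X_mul_pderiv, wt,
    Finsupp.weight_apply, Finsupp.sum_fintype _ _ (by simp), Fin.sum_univ_two]
  simp only [smul_eq_mul]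
  push_cast
  ring

lemma radial_mem_filt {k : ℤ} {f : FormalSeries} (hf : f ∈ filt p k) : radial p f ∈ filt p k :=
  fun m hm => by rw [coeff_radial, hf m hm, mul_zero]

lemma radial_homog {k : ℤ} {f : FormalSeries} (hf : f ∈ homog p k) :
    radial p f = (k : ℂ) • f := by
  ext m
  rw [coeff_radial, MvPowerSeries.coeff_smul]
  by_cases h : wt p m = k
  · rw [h]
  · rw [hf m h, mul_zero, mul_zero]

/-! ### Exponentials of operators that increase the order -/

section Exponential

variable {M M₁ M₂ M₃ : Type*} [AddCommGroup M] [Module ℂ M] [AddCommGroup M₁] [Module ℂ M₁]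
  [AddCommGroup M₂] [Module ℂ M₂] [AddCommGroup M₃] [Module ℂ M₃]

/-- `e` is the sum of `∑ᵢ Dⁱ(u) / i!` with respect to the filtration `G`: the partial sum of the
first `n` terms is equal to `e` modulo `G n`. -/
def IsExpSum (G : ℕ → Submodule ℂ M) (D : M →ₗ[ℂ] M) (u e : M) : Prop :=
  ∀ n : ℕ, e - ∑ i ∈ Finset.range n, (i ! : ℂ)⁻¹ • D^[i] u ∈ G n

lemma iterate_mem {G : ℕ → Submodule ℂ M} {D : M →ₗ[ℂ] M}
    (hD : ∀ n, ∀ u ∈ G n, D u ∈ G (n + 1)) {u : M} (hu : u ∈ G 0) (i : ℕ) : D^[i] u ∈ G i := by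
  induction i with
  | zero => exact hu
  | succ i ih => rw [Function.iterate_succ_apply']; exact hD _ _ ih

lemma map_expTerm (D : M →ₗ[ℂ] M) (u : M) (i : ℕ) :
    D ((i ! : ℂ)⁻¹ • D^[i] u) = ((i : ℂ) + 1) • (((i + 1) ! : ℂ)⁻¹ • D^[i + 1] u) := by
  rw [map_smul, Function.iterate_succ_apply', smul_smul, Nat.factorial_succ]
  congr 1
  have h1 : ((i : ℂ) + 1) ≠ 0 := Nat.cast_add_one_ne_zero i
  have h2 : (i ! : ℂ) ≠ 0 := Nat.cast_ne_zero.2 (Nat.factorial_ne_zero i)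
  push_cast
  field_simp

/-- Leibniz' rule for the divided powers of operators `D₁`, `D₂`, `D₃` related by
`D₃ B(u, v) = B(D₁ u, v) + B(u, D₂ v)`. -/
lemma expTerm_bilinear (B : M₁ →ₗ[ℂ] M₂ →ₗ[ℂ] M₃) (D₁ : M₁ →ₗ[ℂ] M₁) (D₂ : M₂ →ₗ[ℂ] M₂)
    (D₃ : M₃ →ₗ[ℂ] M₃) (hB : ∀ u v, D₃ (B u v) = B (D₁ u) v + B u (D₂ v)) (u : M₁) (v : M₂)
    (n : ℕ) :
    (n ! : ℂ)⁻¹ • D₃^[n] (B u v) = ∑ q ∈ Finset.HasAntidiagonal.antidiagonal n,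
      B ((q.1 ! : ℂ)⁻¹ • D₁^[q.1] u) ((q.2 ! : ℂ)⁻¹ • D₂^[q.2] v) := by
  induction n with
  | zero => simp
  | succ n ih =>
    have h1 : ((n : ℂ) + 1) ≠ 0 := Nat.cast_add_one_ne_zero n
    refine smul_right_injective M₃ h1 ?_
    simp only
    rw [← map_expTerm, ih, map_sum]
    simp only [hB, map_expTerm]
    rw [Finset.sum_add_distrib, Finset.smul_sum]
    have h2 : ∑ q ∈ Finset.HasAntidiagonal.antidiagonal (n + 1), ((n : ℂ) + 1) •
          B ((q.1 ! : ℂ)⁻¹ • D₁^[q.1] u) ((q.2 ! : ℂ)⁻¹ • D₂^[q.2] v) =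
        ∑ q ∈ Finset.HasAntidiagonal.antidiagonal (n + 1), ((q.1 : ℂ) •
          B ((q.1 ! : ℂ)⁻¹ • D₁^[q.1] u) ((q.2 ! : ℂ)⁻¹ • D₂^[q.2] v)) +
        ∑ q ∈ Finset.HasAntidiagonal.antidiagonal (n + 1), ((q.2 : ℂ) •
          B ((q.1 ! : ℂ)⁻¹ • D₁^[q.1] u) ((q.2 ! : ℂ)⁻¹ • D₂^[q.2] v)) := by
      rw [← Finset.sum_add_distrib]
      refine Finset.sum_congr rfl fun q hq => ?_
      rw [← add_smul]
      congr 1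
      exact_mod_cast (Finset.HasAntidiagonal.mem_antidiagonal.1 hq).symm
    rw [h2]
    congr 1
    · rw [Finset.Nat.sum_antidiagonal_succ]
      simp only [Nat.cast_zero, zero_smul, zero_add, Nat.cast_add, Nat.cast_one, map_smul,
        LinearMap.smul_apply]
      exact Finset.sum_congr rfl fun q _ => smul_comm _ _ _
    · rw [Finset.Nat.sum_antidiagonal_succ']
      simp only [Nat.cast_zero, zero_smul, zero_add, Nat.cast_add, Nat.cast_one, map_smul]

/-- The exponential is compatible with bilinear maps that satisfy Leibniz' rule. Applied to the
product of series it says that the exponential of a derivation is multiplicative; applied to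
the action of fields on series it computes the conjugate of a field by an exponential. -/
lemma IsExpSum.bilinear {G₁ : ℕ → Submodule ℂ M₁} {G₂ : ℕ → Submodule ℂ M₂}
    {G₃ : ℕ → Submodule ℂ M₃} (B : M₁ →ₗ[ℂ] M₂ →ₗ[ℂ] M₃) {D₁ : M₁ →ₗ[ℂ] M₁} {D₂ : M₂ →ₗ[ℂ] M₂}
    {D₃ : M₃ →ₗ[ℂ] M₃} (hB : ∀ u v, D₃ (B u v) = B (D₁ u) v + B u (D₂ v))
    (hG : ∀ i j, ∀ u ∈ G₁ i, ∀ v ∈ G₂ j, B u v ∈ G₃ (i + j))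
    (hD₁ : ∀ n, ∀ u ∈ G₁ n, D₁ u ∈ G₁ (n + 1))
    {u e : M₁} {v e' : M₂} (hu0 : u ∈ G₁ 0)
    (hu : IsExpSum G₁ D₁ u e) (hv : IsExpSum G₂ D₂ v e') :
    IsExpSum G₃ D₃ (B u v) (B e e') := by
  intro n
  have he' : e' ∈ G₂ 0 := by
    have := hv 0
    simpa using this
  simp only [expTerm_bilinear B D₁ D₂ D₃ hB]
  set U : ℕ → M₁ := fun i => (i ! : ℂ)⁻¹ • D₁^[i] u with hU
  set V : ℕ → M₂ := fun i => (i ! : ℂ)⁻¹ • D₂^[i] v with hV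
  have h1 : ∑ l ∈ Finset.range n, ∑ q ∈ Finset.HasAntidiagonal.antidiagonal l, B (U q.1) (V q.2) =
      ∑ i ∈ Finset.range n, ∑ j ∈ Finset.range (n - i), B (U i) (V j) := by
    rw [← Finset.sum_range_diag_flip n fun i j => B (U i) (V j)]
    refine Finset.sum_congr rfl fun l _ => ?_
    rw [Finset.Nat.sum_antidiagonal_eq_sum_range_succ fun i j => B (U i) (V j)]
  have h2 : B e e' - ∑ i ∈ Finset.range n, ∑ j ∈ Finset.range (n - i), B (U i) (V j) =
      B (e - ∑ i ∈ Finset.range n, U i) e' +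
        ∑ i ∈ Finset.range n, B (U i) (e' - ∑ j ∈ Finset.range (n - i), V j) := by
    simp only [map_sub, map_sum, LinearMap.sub_apply, LinearMap.sum_apply,
      Finset.sum_sub_distrib]
    abel
  rw [h1, h2]
  refine Submodule.add_mem _ (hG n 0 _ (hu n) _ he') (Submodule.sum_mem _ fun i hi => ?_)
  have h3 := hG i (n - i) (U i) (Submodule.smul_mem _ _ (iterate_mem hD₁ hu0 i)) _ (hv (n - i))
  rwa [Nat.add_sub_cancel' (Finset.mem_range.1 hi).le] at h3

end Exponential

/-- The filtration of `ℂ⟦x, y⟧` from degree `k` on, indexed by natural numbers. -/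
abbrev filtFrom (p : Fin 2 → ℕ) (k : ℤ) (n : ℕ) : Submodule ℂ FormalSeries := filt p (k + n)

lemma IsExpSum.unique {k k' : ℤ} {D : FormalSeries →ₗ[ℂ] FormalSeries} {u e e' : FormalSeries}
    (he : IsExpSum (filtFrom p k) D u e) (he' : IsExpSum (filtFrom p k') D u e') : e = e' := by
  rw [← sub_eq_zero]
  refine eq_zero_of_forall_mem_filt (p := p) (min k k') fun n => ?_
  have h1 : _ ∈ filt p (min k k' + n) := filt_anti (by gcongr; exact min_le_left _ _) (he n)
  have h2 : _ ∈ filt p (min k k' + n) := filt_anti (by gcongr; exact min_le_right _ _) (he' n)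
  have := Submodule.sub_mem _ h1 h2
  rwa [sub_sub_sub_cancel_right] at this

lemma exists_isExpSum {Z : FormalField} (hZ : ∀ k : ℤ, ∀ f ∈ filt p k, Z f ∈ filt p (k + 1))
    (f : FormalSeries) :
    ∃ e, IsExpSum (filtFrom p 0) (Z : FormalSeries →ₗ[ℂ] FormalSeries) f e := by
  refine exists_limit 0 _ fun n => ?_
  rw [Finset.sum_range_succ, add_sub_cancel_left]
  refine Submodule.smul_mem _ _ (iterate_mem (G := filtFrom p 0) ?_ ?_ n)
  · intro n u hu
    have := hZ _ u hu
    rw [add_assoc] at this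
    exact_mod_cast this
  · exact mem_filt_of_nonpos (by simp) _

lemma field_mem_filtFrom {Z : FormalField} (hZ : ∀ k : ℤ, ∀ f ∈ filt p k, Z f ∈ filt p (k + 1))
    (k : ℤ) (n : ℕ) (f : FormalSeries) (hf : f ∈ filtFrom p k n) : Z f ∈ filtFrom p k (n + 1) := by
  have := hZ _ f hf
  rw [add_assoc] at this
  exact_mod_cast this

lemma mem_filtFrom_zero (f : FormalSeries) : f ∈ filtFrom p 0 0 :=
  mem_filt_of_nonpos (by simp) _

lemma IsExpSum.sub_mem {Z : FormalField} (hZ : ∀ k : ℤ, ∀ f ∈ filt p k, Z f ∈ filt p (k + 1))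
    {k : ℤ} {u e : FormalSeries} (hu : u ∈ filt p k)
    (he : IsExpSum (filtFrom p 0) (Z : FormalSeries →ₗ[ℂ] FormalSeries) u e) :
    e - u ∈ filt p (k + 1) := by
  have h1 : _ ∈ filt p (k + 1) := filt_anti (by push_cast; omega) (he ((k + 1).toNat + 1))
  rw [Finset.sum_range_succ'] at h1
  have h2 : ∑ i ∈ Finset.range (k + 1).toNat, ((i + 1) ! : ℂ)⁻¹ •
      (Z : FormalSeries →ₗ[ℂ] FormalSeries)^[i + 1] u ∈ filt p (k + 1) := by
    refine Submodule.sum_mem _ fun i _ => Submodule.smul_mem _ _ ?_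
    have hu' : u ∈ filtFrom p k 0 := filt_anti (by simp) hu
    exact filt_anti (by push_cast; omega)
      (iterate_mem (G := filtFrom p k) (field_mem_filtFrom hZ k) hu' (i + 1))
  have h3 := Submodule.add_mem _ h1 h2
  rw [← sub_sub, sub_right_comm, sub_add_cancel] at h3
  simpa using h3

/-- A field that increases the order by at least one has an exponential, which is a formal
diffeomorphism. Surjectivity is the fixed point property for `w ↦ g - (exp Z (w) - w)`. -/
lemma exists_formalDiffeo_isExpSum {Z : FormalField}
    (hZ : ∀ k : ℤ, ∀ f ∈ filt p k, Z f ∈ filt p (k + 1)) :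
    ∃ Φ : FormalDiffeo, ∀ f,
      IsExpSum (filtFrom p 0) (Z : FormalSeries →ₗ[ℂ] FormalSeries) f (Φ f) := by
  choose E hE using exists_isExpSum (p := p) hZ
  have hC : ∀ c : ℂ, E (algebraMap ℂ FormalSeries c) = algebraMap ℂ FormalSeries c := by
    intro c
    refine (hE _).unique (k' := 0) fun n => ?_
    cases n with
    | zero => exact mem_filtFrom_zero _
    | succ n =>
      rw [Finset.sum_range_succ', Finset.sum_eq_zero]
      · simp
      · intro i _
        rw [Function.iterate_succ_apply]
        have : (Z : FormalSeries →ₗ[ℂ] FormalSeries) (algebraMap ℂ FormalSeries c) = 0 :=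
          Z.map_algebraMap c
        rw [this, iterate_map_zero, smul_zero]
  have hadd : ∀ f g, E (f + g) = E f + E g := by
    intro f g
    refine (hE _).unique (k' := 0) fun n => ?_
    have := Submodule.add_mem _ (hE f n) (hE g n)
    simpa only [iterate_map_add, smul_add, Finset.sum_add_distrib, add_sub_add_comm] using this
  have hmul : ∀ f g, E (f * g) = E f * E g := by
    intro f g
    have := IsExpSum.bilinear (G₃ := filtFrom p 0)
      (D₃ := (Z : FormalSeries →ₗ[ℂ] FormalSeries)) (LinearMap.mul ℂ FormalSeries) (fun u v => by
        simp [mul_comm, add_comm])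
      (fun i j u hu v hv => by
        have := mul_mem_filt hu hv
        refine filt_anti ?_ this
        push_cast
        linarith) (field_mem_filtFrom hZ 0) (mem_filtFrom_zero f) (hE f) (hE g)
    exact (hE _).unique this
  let e : FormalSeries →ₐ[ℂ] FormalSeries :=
    { toFun := E
      map_one' := by simpa using hC 1
      map_mul' := hmul
      map_zero' := by simpa using hC 0
      map_add' := hadd
      commutes' := hC }
  have he : ∀ k : ℤ, ∀ f ∈ filt p k, e f - f ∈ filt p (k + 1) :=
    fun k f hf => (hE f).sub_mem hZ hf
  have hbij : Function.Bijective e := by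
    constructor
    · rw [injective_iff_map_eq_zero]
      intro f hf
      refine eq_zero_of_forall_mem_filt (p := p) 0 fun n => ?_
      induction n with
      | zero => exact mem_filtFrom_zero _
      | succ n ih =>
        have := he _ f ih
        rw [hf, zero_sub, Submodule.neg_mem_iff, add_assoc] at this
        exact_mod_cast this
    · intro g
      obtain ⟨w, -, hw⟩ := exists_fixedPoint (p := p) 0 (fun w => g - (e w - w))
        (fun w _ => mem_filt_of_nonpos le_rfl _)
        (fun w _ w' _ j _ hj => by
          have := Submodule.neg_mem _ (he j _ hj)
          rw [map_sub] at this
          convert this using 1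
          ring)
      exact ⟨w, by linear_combination -hw⟩
  exact ⟨AlgEquiv.ofBijective e hbij, hE⟩

/-- Convergence for the quasi-homogeneous filtration implies convergence of every coefficient. -/
lemma IsExpSum.isExp {Z : FormalField} (hZ : ∀ k : ℤ, ∀ f ∈ filt p k, Z f ∈ filt p (k + 1))
    {Φ : FormalDiffeo} (hΦ : ∀ f,
      IsExpSum (filtFrom p 0) (Z : FormalSeries →ₗ[ℂ] FormalSeries) f (Φ f)) :
    IsExp Z Φ := by
  intro f m
  set N : ℕ := (wt p m + 1).toNat with hN
  have hm : wt p m < N := by omega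
  have h1 := hΦ f N m (by simpa using hm)
  rw [map_sub, map_sum, sub_eq_zero] at h1
  rw [h1]
  simp only [MvPowerSeries.coeff_smul]
  refine hasSum_sum_of_ne_finset_zero fun n hn => ?_
  have h2 := iterate_mem (G := filtFrom p 0) (field_mem_filtFrom hZ 0) (mem_filtFrom_zero f) n
  have h3 : Z^[n] f ∈ filt p (0 + n) := h2
  rw [h3 m, mul_zero]
  have : (N : ℤ) ≤ n := by exact_mod_cast not_lt.1 fun h => hn (Finset.mem_range.2 h)
  linarith

/-! ### Conjugation of `W + f R` by `exp(bR)` -/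

/-- The filtration of the pairs `(A, C)`, thought of as fields `A W + C R` with `W`
of degree `k`. -/
abbrev pairFilt (p : Fin 2 → ℕ) (k : ℤ) (n : ℤ) : Submodule ℂ (FormalSeries × FormalSeries) :=
  (filt p n).prod (filt p (n + k))

/-- The bracket with `b R` on the fields `A W + C R`, where `[R, W] = k W`, read on the pair of
coefficients `(A, C)`. -/
def bracketPair (p : Fin 2 → ℕ) (W : FormalField) (k : ℤ) (b : FormalSeries) :
    FormalSeries × FormalSeries →ₗ[ℂ] FormalSeries × FormalSeries where
  toFun q := (b * radial p q.1 + (k : FormalSeries) * b * q.1,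
    b * radial p q.2 - q.2 * radial p b - q.1 * W b)
  map_add' q r := by
    ext1
    · simp only [Prod.fst_add, map_add]; ring
    · simp only [Prod.fst_add, Prod.snd_add, map_add]; ring
  map_smul' c q := by
    ext1
    · simp only [Prod.smul_fst, Derivation.map_smul, RingHom.id_apply, mul_smul_comm, smul_add]
    · simp only [Prod.smul_fst, Prod.smul_snd, Derivation.map_smul, RingHom.id_apply, mul_smul_comm,
        smul_mul_assoc, smul_sub]

/-- The action `(A W + C R)(g)` as a bilinear map of `(A, C)` and `g`. -/
def pairAction (p : Fin 2 → ℕ) (W : FormalField) :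
    FormalSeries × FormalSeries →ₗ[ℂ] FormalSeries →ₗ[ℂ] FormalSeries :=
  LinearMap.mk₂ ℂ (fun q g => q.1 * W g + q.2 * radial p g)
    (fun q r g => by simp only [Prod.fst_add, Prod.snd_add]; ring)
    (fun c q g => by simp only [Prod.smul_fst, Prod.smul_snd, smul_mul_assoc, smul_add])
    (fun q g h => by simp only [map_add]; ring)
    (fun c q g => by simp only [Derivation.map_smul, mul_smul_comm, smul_add])

lemma pairAction_apply (W : FormalField) (q : FormalSeries × FormalSeries) (g : FormalSeries) :
    pairAction p W q g = q.1 * W g + q.2 * radial p g := rfl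

lemma bracketPair_fst (W : FormalField) (k : ℤ) (b : FormalSeries)
    (q : FormalSeries × FormalSeries) :
    (bracketPair p W k b q).1 = b * radial p q.1 + (k : FormalSeries) * b * q.1 := rfl

lemma bracketPair_snd (W : FormalField) (k : ℤ) (b : FormalSeries)
    (q : FormalSeries × FormalSeries) :
    (bracketPair p W k b q).2 = b * radial p q.2 - q.2 * radial p b - q.1 * W b := rfl

lemma pairAction_leibniz {W : FormalField} {k : ℤ}
    (hW : ∀ g, radial p (W g) = W (radial p g) + (k : FormalSeries) * W g)
    (b : FormalSeries) (q : FormalSeries × FormalSeries) (g : FormalSeries) :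
    (b • radial p : FormalField) (pairAction p W q g) =
      pairAction p W (bracketPair p W k b q) g +
        pairAction p W q ((b • radial p : FormalField) g) := by
  simp only [pairAction_apply, bracketPair_fst, bracketPair_snd, Derivation.smul_apply, map_add,
    Derivation.leibniz, smul_eq_mul, hW]
  ring

lemma intCast_mul_mem {k l : ℤ} {f : FormalSeries} (hf : f ∈ filt p k) :
    (l : FormalSeries) * f ∈ filt p k := by
  rw [← zsmul_eq_mul]
  exact zsmul_mem hf l

lemma bracketPair_mem {W : FormalField} {k : ℤ}
    (hWk : ∀ l : ℤ, ∀ f ∈ filt p l, W f ∈ filt p (l + k)) {j : ℤ} {b : FormalSeries}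
    (hb : b ∈ filt p j) {n : ℤ} {q : FormalSeries × FormalSeries} (hq : q ∈ pairFilt p k n) :
    bracketPair p W k b q ∈ pairFilt p k (n + j) := by
  obtain ⟨h1, h2⟩ := hq
  constructor
  · refine Submodule.add_mem _ ?_ ?_
    · exact filt_anti (by linarith) (mul_mem_filt hb (radial_mem_filt h1))
    · exact filt_anti (by linarith) (mul_mem_filt (intCast_mul_mem hb) h1)
  · refine Submodule.sub_mem _ (Submodule.sub_mem _ ?_ ?_) ?_
    · exact filt_anti (by linarith) (mul_mem_filt hb (radial_mem_filt h2))
    · exact filt_anti (by linarith) (mul_mem_filt h2 (radial_mem_filt hb))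
    · exact filt_anti (by linarith) (mul_mem_filt h1 (hWk _ _ hb))

lemma bracketPair_sub (W : FormalField) (k : ℤ) (b b' : FormalSeries)
    (q : FormalSeries × FormalSeries) :
    bracketPair p W k b q - bracketPair p W k b' q = bracketPair p W k (b - b') q := by
  ext1
  · simp only [bracketPair_fst, Prod.fst_sub]; ring
  · simp only [bracketPair_snd, Prod.snd_sub, map_sub]; ring

lemma iterate_bracketPair_mem {W : FormalField} {k : ℤ}
    (hWk : ∀ l : ℤ, ∀ f ∈ filt p l, W f ∈ filt p (l + k)) {b : FormalSeries}
    (hb : b ∈ filt p 1) {q : FormalSeries × FormalSeries} (hq : q ∈ pairFilt p k 0) (i : ℕ) :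
    (bracketPair p W k b)^[i] q ∈ pairFilt p k i := by
  induction i with
  | zero => exact hq
  | succ i ih =>
    rw [Function.iterate_succ_apply']
    exact_mod_cast bracketPair_mem hWk hb ih

lemma iterate_bracketPair_sub_mem {W : FormalField} {k : ℤ}
    (hWk : ∀ l : ℤ, ∀ f ∈ filt p l, W f ∈ filt p (l + k)) {b b' : FormalSeries}
    (hb : b ∈ filt p 1) (hb' : b' ∈ filt p 1) {j : ℤ} (hbb' : b - b' ∈ filt p j)
    {q : FormalSeries × FormalSeries} (hq : q ∈ pairFilt p k 0) (i : ℕ) :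
    (bracketPair p W k b)^[i + 1] q - (bracketPair p W k b')^[i + 1] q ∈
      pairFilt p k (j + i) := by
  induction i with
  | zero =>
    have := bracketPair_mem hWk hbb' hq
    rw [← bracketPair_sub] at this
    simpa [add_comm] using this
  | succ i ih =>
    rw [Function.iterate_succ_apply', Function.iterate_succ_apply' _ (i + 1)]
    have h1 := bracketPair_mem hWk hb ih
    rw [map_sub] at h1
    have h2 := bracketPair_mem hWk hbb' (iterate_bracketPair_mem hWk hb' hq (i + 1))
    rw [← bracketPair_sub] at h2
    have h3 := Submodule.add_mem (pairFilt p k (j + ((i + 1 : ℕ) : ℤ)))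
      (by convert h1 using 2; push_cast; ring) (by convert h2 using 2; push_cast; ring)
    rwa [sub_add_sub_cancel] at h3

/-- Conjugation of `W + f R` by the exponentials of the fields `b R`, where `[R, W] = k W`: the
result is a field `A W + C R`, where `A = 1 + ⋯`, `C = f - W(b) + ⋯`, and where the terms of `A`
and `C` that are not written depend on `b` in a strictly triangular way. -/
lemma exists_conjugation {W : FormalField} {k : ℤ}
    (hW : ∀ g, radial p (W g) = W (radial p g) + (k : FormalSeries) * W g)
    (hWk : ∀ l : ℤ, ∀ f ∈ filt p l, W f ∈ filt p (l + k)) {f : FormalSeries}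
    (hf : f ∈ filt p (k + 1)) :
    ∃ A C : FormalSeries → FormalSeries,
      (∀ b ∈ filt p 1, A b - 1 ∈ filt p 1 ∧ C b ∈ filt p (k + 1)) ∧
      (∀ b ∈ filt p 1, ∀ b' ∈ filt p 1, ∀ j : ℤ, 1 ≤ j → b - b' ∈ filt p j →
        A b - A b' ∈ filt p j ∧ C b - C b' + W (b - b') ∈ filt p (j + k + 1)) ∧
      ∀ b ∈ filt p 1, ∀ Φ : FormalDiffeo,
        (∀ g, IsExpSum (filtFrom p 0)
          ((b • radial p : FormalField) : FormalSeries →ₗ[ℂ] FormalSeries) g (Φ g)) →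
        ∀ g, Φ (W g + f * radial p g) = A b * W (Φ g) + C b * radial p (Φ g) := by
  -- `(A, C)` is the exponential of `bracketPair` applied to the pair `(1, f)`
  set q : FormalSeries × FormalSeries := (1, f) with hqdef
  have hq : q ∈ pairFilt p k 0 :=
    ⟨mem_filt_of_nonpos le_rfl _, filt_anti (by linarith) hf⟩
  have hex : ∀ b : FormalSeries, ∃ P : FormalSeries × FormalSeries, b ∈ filt p 1 →
      IsExpSum (fun n : ℕ => pairFilt p k n) (bracketPair p W k b) q P := by
    intro b
    by_cases hb : b ∈ filt p 1
    · have hd : ∀ n : ℕ, ∑ i ∈ Finset.range (n + 1), (i ! : ℂ)⁻¹ • (bracketPair p W k b)^[i] q -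
          ∑ i ∈ Finset.range n, (i ! : ℂ)⁻¹ • (bracketPair p W k b)^[i] q ∈ pairFilt p k n := by
        intro n
        rw [Finset.sum_range_succ, add_sub_cancel_left]
        exact Submodule.smul_mem _ _ (iterate_bracketPair_mem hWk hb hq n)
      obtain ⟨A, hA⟩ := exists_limit (p := p) 0
        (fun n => (∑ i ∈ Finset.range n, (i ! : ℂ)⁻¹ • (bracketPair p W k b)^[i] q).1)
        (fun n => by rw [zero_add]; exact (hd n).1)
      obtain ⟨C, hC⟩ := exists_limit (p := p) k
        (fun n => (∑ i ∈ Finset.range n, (i ! : ℂ)⁻¹ • (bracketPair p W k b)^[i] q).2)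
        (fun n => by rw [add_comm]; exact (hd n).2)
      refine ⟨(A, C), fun _ n => ⟨?_, ?_⟩⟩
      · have := hA n
        rwa [zero_add] at this
      · have := hC n
        rwa [add_comm] at this
    · exact ⟨0, fun h => absurd h hb⟩
  choose P hP using hex
  refine ⟨fun b => (P b).1, fun b => (P b).2, ?_, ?_, ?_⟩
  · intro b hb
    have h1 := hP b hb 1
    simp only [Finset.sum_range_one, Nat.factorial_zero, Nat.cast_one, inv_one, one_smul,
      Function.iterate_zero, id_eq] at h1
    refine ⟨h1.1, ?_⟩
    have h2 : (P b).2 - f ∈ filt p (k + 1) := by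
      rw [add_comm]
      exact h1.2
    have h3 := Submodule.add_mem _ h2 hf
    rwa [sub_add_cancel] at h3
  · intro b hb b' hb' j hj hbb'
    set N : ℕ := j.toNat + 2 with hN
    -- the terms of index `≥ 2` of the exponential only see `b - b'` multiplied by `b` or `b'`
    have htail : ∑ i ∈ Finset.range j.toNat, ((i + 2) ! : ℂ)⁻¹ •
        ((bracketPair p W k b)^[i + 1 + 1] q - (bracketPair p W k b')^[i + 1 + 1] q) ∈
        pairFilt p k (j + 1) := by
      refine Submodule.sum_mem _ fun i _ => Submodule.smul_mem _ _ ?_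
      have := iterate_bracketPair_sub_mem hWk hb hb' hbb' hq (i + 1)
      exact ⟨filt_anti (by push_cast; linarith) this.1, filt_anti (by push_cast; linarith) this.2⟩
    have hle : (j + 1) ≤ (N : ℤ) := by omega
    have hb1 : _ ∈ pairFilt p k (j + 1) := ⟨filt_anti hle (hP b hb N).1,
      filt_anti (by linarith) (hP b hb N).2⟩
    have hb2 : _ ∈ pairFilt p k (j + 1) := ⟨filt_anti hle (hP b' hb' N).1,
      filt_anti (by linarith) (hP b' hb' N).2⟩
    have key : P b - P b' - bracketPair p W k (b - b') q ∈ pairFilt p k (j + 1) := by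
      have := Submodule.add_mem _ (Submodule.sub_mem _ hb1 hb2) htail
      convert this using 1
      rw [hN, Finset.sum_range_succ', Finset.sum_range_succ', Finset.sum_range_succ',
        Finset.sum_range_succ']
      simp only [smul_sub, Finset.sum_sub_distrib, ← bracketPair_sub]
      simp only [zero_add, Nat.factorial_zero, Nat.factorial_one, Nat.cast_one, inv_one, one_smul,
        Function.iterate_zero, id_eq, Function.iterate_one]
      abel
    constructor
    · have h1 := (bracketPair_mem hWk hbb' hq).1
      rw [zero_add] at h1
      have h2 := Submodule.add_mem _ (filt_anti (by linarith) key.1) h1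
      simpa using h2
    · have h2 : (P b).2 - (P b').2 - (bracketPair p W k (b - b') q).2 ∈ filt p (j + k + 1) :=
        filt_anti (by linarith) key.2
      rw [bracketPair_snd, hqdef] at h2
      simp only [one_mul] at h2
      have h3 : (b - b') * radial p f ∈ filt p (j + k + 1) :=
        filt_anti (by linarith) (mul_mem_filt hbb' (radial_mem_filt hf))
      have h4 : f * radial p (b - b') ∈ filt p (j + k + 1) :=
        filt_anti (by linarith) (mul_mem_filt hf (radial_mem_filt hbb'))
      have h5 := Submodule.add_mem _ h2 (Submodule.sub_mem _ h3 h4)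
      convert h5 using 1
      ring
  · intro b hb Φ hΦ g
    have h1 := IsExpSum.bilinear (G₃ := filtFrom p k)
      (D₃ := ((b • radial p : FormalField) : FormalSeries →ₗ[ℂ] FormalSeries)) (pairAction p W)
      (pairAction_leibniz hW b)
      (fun i j u hu v hv => by
        refine Submodule.add_mem _ ?_ ?_
        · refine filt_anti ?_ (mul_mem_filt hu.1 (hWk _ _ hv))
          push_cast
          linarith
        · refine filt_anti ?_ (mul_mem_filt hu.2 (radial_mem_filt hv))
          push_cast
          linarith)
      (fun n u hu => by exact_mod_cast bracketPair_mem hWk hb hu)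
      (by simpa using hq) (hP b hb) (hΦ g)
    have h2 := (hΦ _).unique h1
    simpa only [pairAction_apply, hqdef, one_mul] using h2

/-! ### The initial field -/

lemma coe_mem_homog {f : MvPolynomial (Fin 2) ℂ} {k : ℕ}
    (hf : MvPolynomial.IsWeightedHomogeneous p f k) : (f : FormalSeries) ∈ homog p k := by
  intro m hm
  rw [MvPolynomial.coeff_coe]
  by_contra h
  exact hm (by rw [wt, hf h])

lemma initialField_apply (h : MvPolynomial (Fin 2) ℂ) (δ : ℕ) (f : FormalSeries) :
    initialField h δ f = (δ : ℂ)⁻¹ •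
      (MvPowerSeries.pderiv ℂ 1 (h : FormalSeries) * MvPowerSeries.pderiv ℂ 0 f -
        MvPowerSeries.pderiv ℂ 0 (h : FormalSeries) * MvPowerSeries.pderiv ℂ 1 f) := rfl

lemma initialField_self (h : MvPolynomial (Fin 2) ℂ) (δ : ℕ) :
    initialField h δ (h : FormalSeries) = 0 := by
  rw [initialField_apply, mul_comm, sub_self, smul_zero]

variable {h : MvPolynomial (Fin 2) ℂ} {δ : ℕ}

lemma initialField_mem_filt (hh : (h : FormalSeries) ∈ homog p δ) (k : ℤ) (f : FormalSeries)
    (hf : f ∈ filt p k) : initialField h δ f ∈ filt p (k + ((δ : ℤ) - p 0 - p 1)) := by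
  rw [initialField_apply]
  refine Submodule.smul_mem _ _ (Submodule.sub_mem _ ?_ ?_)
  · exact filt_anti (by linarith)
      (mul_mem_filt (homog_le_filt (pderiv_mem_homog hh 1)) (pderiv_mem_filt hf 0))
  · exact filt_anti (by linarith)
      (mul_mem_filt (homog_le_filt (pderiv_mem_homog hh 0)) (pderiv_mem_filt hf 1))

lemma comp_initialField (hh : (h : FormalSeries) ∈ homog p δ) (k : ℤ) (f : FormalSeries) :
    comp p k (initialField h δ f) =
      initialField h δ (comp p (k - ((δ : ℤ) - p 0 - p 1)) f) := by
  rw [initialField_apply, initialField_apply, comp_smul, comp_sub,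
    comp_mul _ (pderiv_mem_homog hh 1), comp_mul _ (pderiv_mem_homog hh 0), comp_pderiv,
    comp_pderiv]
  have h1 : k - (δ - p 1) + p 0 = k - ((δ : ℤ) - p 0 - p 1) := by ring
  have h2 : k - (δ - p 0) + p 1 = k - ((δ : ℤ) - p 0 - p 1) := by ring
  rw [h1, h2]

lemma intCast_mul (k : ℤ) (f : FormalSeries) : (k : FormalSeries) * f = (k : ℂ) • f := by
  rw [← zsmul_eq_mul, Int.cast_smul_eq_zsmul]

lemma comp_radial (k : ℤ) (f : FormalSeries) :
    comp p k (radial p f) = (k : ℂ) • comp p k f := by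
  ext m
  rw [coeff_comp, MvPowerSeries.coeff_smul, coeff_comp, coeff_radial]
  split_ifs with hk
  · rw [hk]
  · rw [mul_zero]

/-- `[R, X₀] = δ₀ X₀`. -/
lemma radial_initialField (hh : (h : FormalSeries) ∈ homog p δ) (g : FormalSeries) :
    radial p (initialField h δ g) = initialField h δ (radial p g) +
      (((δ : ℤ) - p 0 - p 1 : ℤ) : FormalSeries) * initialField h δ g := by
  refine ext_comp (p := p) fun k => ?_
  rw [comp_add, intCast_mul, comp_smul, comp_radial, comp_initialField hh, comp_initialField hh,
    comp_radial, Derivation.map_smul, ← add_smul, ← Int.cast_add, sub_add_cancel]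

/-! ### The homological equation -/

lemma radial_eq_intCast_mul {k : ℤ} {f : FormalSeries} (hf : f ∈ homog p k) :
    (p 0 : FormalSeries) * MvPowerSeries.X 0 * MvPowerSeries.pderiv ℂ 0 f +
      (p 1 : FormalSeries) * MvPowerSeries.X 1 * MvPowerSeries.pderiv ℂ 1 f =
        (k : FormalSeries) * f := by
  rw [← radial_apply, radial_homog hf, intCast_mul]

/-- Cartan's formula `L_R η = d(i_R η) + i_R(dη)` for the quasi-homogeneous form
`η = α dy - β dx`, multiplied by `dh`: an element `α h_x + β h_y` of the Jacobian ideal is, up to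
the image of `X₀`, a multiple of `h`. -/
lemma euler_identity (hh : (h : FormalSeries) ∈ homog p δ) {m : ℤ} {α β : FormalSeries}
    (hα : α ∈ homog p (m - (δ - p 0))) (hβ : β ∈ homog p (m - (δ - p 1))) {ψ : FormalSeries}
    (hψ : ψ = (p 1 : FormalSeries) * MvPowerSeries.X 1 * α -
      (p 0 : FormalSeries) * MvPowerSeries.X 0 * β) :
    ((m - ((δ : ℤ) - p 0 - p 1) : ℤ) : FormalSeries) *
        (MvPowerSeries.pderiv ℂ 0 (h : FormalSeries) * α +
          MvPowerSeries.pderiv ℂ 1 (h : FormalSeries) * β) =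
      MvPowerSeries.pderiv ℂ 0 (h : FormalSeries) * MvPowerSeries.pderiv ℂ 1 ψ -
        MvPowerSeries.pderiv ℂ 1 (h : FormalSeries) * MvPowerSeries.pderiv ℂ 0 ψ +
      (δ : FormalSeries) * ((h : FormalSeries) *
        (MvPowerSeries.pderiv ℂ 0 α + MvPowerSeries.pderiv ℂ 1 β)) := by
  have h1 := radial_eq_intCast_mul hα
  have h2 := radial_eq_intCast_mul hβ
  have h3 := radial_eq_intCast_mul hh
  have hc : ∀ i j, MvPowerSeries.pderiv ℂ i (p j : FormalSeries) = 0 :=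
    fun i j => Derivation.map_natCast _ _
  have h10 : MvPowerSeries.pderiv ℂ (1 : Fin 2) (MvPowerSeries.X 0) = 0 :=
    MvPowerSeries.pderiv_X_of_ne (by simp)
  have h01 : MvPowerSeries.pderiv ℂ (0 : Fin 2) (MvPowerSeries.X 1) = 0 :=
    MvPowerSeries.pderiv_X_of_ne (by simp)
  have e1 : MvPowerSeries.pderiv ℂ 1 ψ = (p 1 : FormalSeries) * α +
      (p 1 : FormalSeries) * MvPowerSeries.X 1 * MvPowerSeries.pderiv ℂ 1 α -
      (p 0 : FormalSeries) * MvPowerSeries.X 0 * MvPowerSeries.pderiv ℂ 1 β := by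
    rw [hψ]
    simp only [map_sub, Derivation.leibniz, smul_eq_mul, hc, h10, MvPowerSeries.pderiv_X_self]
    ring
  have e0 : MvPowerSeries.pderiv ℂ 0 ψ =
      (p 1 : FormalSeries) * MvPowerSeries.X 1 * MvPowerSeries.pderiv ℂ 0 α -
      (p 0 : FormalSeries) * β -
      (p 0 : FormalSeries) * MvPowerSeries.X 0 * MvPowerSeries.pderiv ℂ 0 β := by
    rw [hψ]
    simp only [map_sub, Derivation.leibniz, smul_eq_mul, hc, h01, MvPowerSeries.pderiv_X_self]
    ring
  rw [e1, e0]
  push_cast at h1 h2 h3 ⊢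
  linear_combination (-MvPowerSeries.pderiv ℂ 0 (h : FormalSeries)) * h1 -
    MvPowerSeries.pderiv ℂ 1 (h : FormalSeries) * h2 +
    (MvPowerSeries.pderiv ℂ 0 α + MvPowerSeries.pderiv ℂ 1 β) * h3

lemma hasSubst_of_mem_homog (hδ : 0 < δ) (hh : (h : FormalSeries) ∈ homog p δ) :
    PowerSeries.HasSubst (h : FormalSeries) := by
  refine PowerSeries.HasSubst.of_constantCoeff_zero ?_
  rw [← MvPowerSeries.coeff_zero_eq_constantCoeff_apply]
  refine hh 0 ?_
  simp only [wt, map_zero, Nat.cast_zero]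
  exact_mod_cast hδ.ne

/-- The homological equation in degree `m`. The Jacobian ideal part of `g` is rewritten by
`euler_identity` as an element of the image of `X₀` plus a multiple of `h` by a series of degree
`m - δ`, to which the same applies; in degree `m ≤ δ₀` there is no Jacobian ideal part. -/
lemma exists_homological (hp : ∀ i, 0 < p i) (hδ : 0 < δ) (hh : (h : FormalSeries) ∈ homog p δ)
    {μ : ℕ} {a : Fin μ → FormalSeries} {k : Fin μ → ℤ} (ha : ∀ i, a i ∈ homog p (k i))
    (hdec : ∀ g : FormalSeries, ∃ (c : Fin μ → ℂ) (α β : FormalSeries), g = ∑ i, c i • a i +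
      MvPowerSeries.pderiv ℂ 0 (h : FormalSeries) * α +
      MvPowerSeries.pderiv ℂ 1 (h : FormalSeries) * β)
    (m : ℤ) (g : FormalSeries) (hg : g ∈ homog p m) :
    ∃ (τ : FormalSeries) (d : Fin μ → PowerSeries ℂ),
      τ ∈ homog p (m - ((δ : ℤ) - p 0 - p 1)) ∧
      (∀ i n, PowerSeries.coeff n (d i) ≠ 0 → k i + n * δ = m) ∧
      g = initialField h δ τ + ∑ i, PowerSeries.subst (h : FormalSeries) (d i) * a i := by
  have hs := hasSubst_of_mem_homog hδ hh
  have hp0 : (0 : ℤ) < p 0 := by exact_mod_cast hp 0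
  have hp1 : (0 : ℤ) < p 1 := by exact_mod_cast hp 1
  have hδ' : (0 : ℤ) < δ := by exact_mod_cast hδ
  have hδC : (δ : ℂ) ≠ 0 := by exact_mod_cast hδ.ne'
  obtain ⟨N, hN⟩ : ∃ N : ℕ, m < N := ⟨(m + 1).toNat, by omega⟩
  induction N generalizing m g with
  | zero =>
    have hg0 : g = 0 := homog_eq_zero_of_neg (by simpa using hN) hg
    refine ⟨0, 0, Submodule.zero_mem _, fun i n hn => absurd (by simp) hn, ?_⟩
    rw [hg0, map_zero, zero_add, Finset.sum_eq_zero]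
    intro i _
    rw [Pi.zero_apply, ← PowerSeries.coe_substAlgHom hs, map_zero, zero_mul]
  | succ N ih =>
    obtain ⟨c, α, β, hdecg⟩ := hdec g
    -- the components of degree `m` of the terms of the decomposition
    set α' := comp p (m - (δ - p 0)) α
    set β' := comp p (m - (δ - p 1)) β
    set c' : Fin μ → ℂ := fun i => if k i = m then c i else 0 with hc'
    have hαm : α' ∈ homog p (m - (δ - p 0)) := comp_mem _ _
    have hβm : β' ∈ homog p (m - (δ - p 1)) := comp_mem _ _
    have hgc : g = ∑ i, c' i • a i + (MvPowerSeries.pderiv ℂ 0 (h : FormalSeries) * α' +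
        MvPowerSeries.pderiv ℂ 1 (h : FormalSeries) * β') := by
      have h1 := congrArg (comp p m) hdecg
      rw [comp_self hg, comp_add, comp_add, comp_sum, comp_mul _ (pderiv_mem_homog hh 0),
        comp_mul _ (pderiv_mem_homog hh 1), add_assoc] at h1
      rw [h1]
      congr 1
      refine Finset.sum_congr rfl fun i _ => ?_
      rw [comp_smul, hc']
      by_cases hki : k i = m
      · simp only [if_pos hki]
        rw [comp_self (hki ▸ ha i)]
      · simp only [if_neg hki]
        rw [comp_of_ne hki (ha i), smul_zero, zero_smul]
    have hC : ∀ i, PowerSeries.subst (h : FormalSeries) (PowerSeries.C (c' i)) * a i =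
        c' i • a i := by
      intro i
      rw [PowerSeries.subst_C, ← MvPowerSeries.smul_eq_C_mul]
    have hc0 : ∀ i, c' i ≠ 0 → k i = m := by
      intro i hi
      by_contra hki
      exact hi (if_neg hki)
    rcases le_or_gt m ((δ : ℤ) - p 0 - p 1) with hm | hm
    · have hα0 : α' = 0 := homog_eq_zero_of_neg (by linarith) hαm
      have hβ0 : β' = 0 := homog_eq_zero_of_neg (by linarith) hβm
      refine ⟨0, fun i => PowerSeries.C (c' i), Submodule.zero_mem _, fun i n hn => ?_, ?_⟩
      · rw [PowerSeries.coeff_C] at hn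
        split_ifs at hn with hn0
        · rw [hn0, hc0 i hn]
          simp
        · exact absurd rfl hn
      · rw [map_zero, zero_add, hgc, hα0, hβ0, mul_zero, mul_zero, add_zero, add_zero]
        exact Finset.sum_congr rfl fun i _ => (hC i).symm
    · obtain ⟨τ', d', hτ', hd', hdiv⟩ := ih (m - δ)
        (MvPowerSeries.pderiv ℂ 0 α' + MvPowerSeries.pderiv ℂ 1 β')
        (by
          refine Submodule.add_mem _ ?_ ?_
          · have := pderiv_mem_homog hαm 0
            convert this using 2
            ring
          · have := pderiv_mem_homog hβm 1
            convert this using 2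
            ring)
        (by push_cast at hN; linarith)
      set ψ : FormalSeries := (p 1 : FormalSeries) * MvPowerSeries.X 1 * α' -
        (p 0 : FormalSeries) * MvPowerSeries.X 0 * β' with hψ
      have hcast : ∀ (j : ℕ) {l : ℤ} {f : FormalSeries}, f ∈ homog p l →
          (j : FormalSeries) * f ∈ homog p l := by
        intro j l f hf
        rw [← nsmul_eq_mul]
        exact nsmul_mem hf j
      have hψm : ψ ∈ homog p (m - ((δ : ℤ) - p 0 - p 1)) := by
        refine Submodule.sub_mem _ ?_ ?_
        · rw [mul_assoc]
          have := hcast (p 1) (mul_mem_homog (X_mem_homog 1) hαm)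
          convert this using 2
          ring
        · rw [mul_assoc]
          have := hcast (p 0) (mul_mem_homog (X_mem_homog 0) hβm)
          convert this using 2
          ring
      set M : ℂ := ((m - ((δ : ℤ) - p 0 - p 1) : ℤ) : ℂ) with hM
      have hM0 : M ≠ 0 := by
        rw [hM, Int.cast_ne_zero]
        exact (sub_pos.2 hm).ne'
      have heuler := euler_identity hh hαm hβm hψ
      rw [intCast_mul, ← hM] at heuler
      have hX0 : MvPowerSeries.pderiv ℂ 0 (h : FormalSeries) * MvPowerSeries.pderiv ℂ 1 ψ -
          MvPowerSeries.pderiv ℂ 1 (h : FormalSeries) * MvPowerSeries.pderiv ℂ 0 ψ =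
          -((δ : ℂ) • initialField h δ ψ) := by
        rw [initialField_apply, smul_inv_smul₀ hδC]
        ring
      have hδS : (δ : FormalSeries) * ((h : FormalSeries) *
          (MvPowerSeries.pderiv ℂ 0 α' + MvPowerSeries.pderiv ℂ 1 β')) =
          (δ : ℂ) • ((h : FormalSeries) *
          (MvPowerSeries.pderiv ℂ 0 α' + MvPowerSeries.pderiv ℂ 1 β')) := by
        rw [← nsmul_eq_mul, Nat.cast_smul_eq_nsmul]
      rw [hX0, hδS] at heuler
      have hsol : MvPowerSeries.pderiv ℂ 0 (h : FormalSeries) * α' +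
          MvPowerSeries.pderiv ℂ 1 (h : FormalSeries) * β' =
          (M⁻¹ * δ) • ((h : FormalSeries) *
            (MvPowerSeries.pderiv ℂ 0 α' + MvPowerSeries.pderiv ℂ 1 β') -
              initialField h δ ψ) := by
        rw [mul_smul, eq_inv_smul_iff₀ hM0, heuler, smul_sub]
        ring
      clear_value ψ
      refine ⟨(M⁻¹ * δ) • ((h : FormalSeries) * τ' - ψ),
        fun i => PowerSeries.C (c' i) + (M⁻¹ * δ) • (PowerSeries.X * d' i), ?_, ?_, ?_⟩
      · refine Submodule.smul_mem _ _ (Submodule.sub_mem _ ?_ hψm)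
        have := mul_mem_homog hh hτ'
        convert this using 2
        ring
      · intro i n hn
        cases n with
        | zero =>
          simp at hn
          simp [hc0 i hn]
        | succ n =>
          rw [map_add, PowerSeries.coeff_C, if_neg n.succ_ne_zero, zero_add,
            PowerSeries.coeff_smul, PowerSeries.coeff_succ_X_mul] at hn
          have := hd' i n (right_ne_zero_of_mul hn)
          push_cast
          linarith
      · rw [hgc, hsol, hdiv, Derivation.map_smul, map_sub, Derivation.leibniz, initialField_self,
          smul_zero, add_zero, smul_eq_mul]
        have hd : ∀ i, PowerSeries.subst (h : FormalSeries)
            (PowerSeries.C (c' i) + (M⁻¹ * δ) • (PowerSeries.X * d' i)) * a i =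
            c' i • a i + (M⁻¹ * δ) • ((h : FormalSeries) *
              (PowerSeries.subst (h : FormalSeries) (d' i) * a i)) := by
          intro i
          rw [PowerSeries.subst_add hs, PowerSeries.subst_smul hs, PowerSeries.subst_mul hs,
            PowerSeries.subst_X hs, add_mul, hC, smul_mul_assoc, mul_assoc]
        simp only [hd, Finset.sum_add_distrib, ← Finset.smul_sum, ← Finset.mul_sum, smul_sub,
          smul_add, mul_add]
        ring

/-- The component of degree `l` of `d(h)` consists of the terms `dₙ hⁿ` with `n δ = l`. -/
lemma comp_subst (hδ : 0 < δ) (hh : (h : FormalSeries) ∈ homog p δ) (d : PowerSeries ℂ) (l : ℤ) :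
    comp p l (PowerSeries.subst (h : FormalSeries) d) = PowerSeries.subst (h : FormalSeries)
      (PowerSeries.mk fun n => if n * (δ : ℤ) = l then PowerSeries.coeff n d else 0) := by
  have hs := hasSubst_of_mem_homog hδ hh
  ext e
  rw [coeff_comp, PowerSeries.coeff_subst hs, PowerSeries.coeff_subst hs]
  split_ifs with he
  · refine finsum_congr fun n => ?_
    rw [PowerSeries.coeff_mk]
    split_ifs with hn
    · rfl
    · rw [pow_mem_homog hh n e (by rw [he]; exact fun h' => hn h'.symm), smul_zero, smul_zero]
  · refine (finsum_eq_zero_of_forall_eq_zero fun n => ?_).symm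
    rw [PowerSeries.coeff_mk]
    split_ifs with hn
    · rw [pow_mem_homog hh n e (by rw [hn]; exact he), smul_zero]
    · rw [zero_smul]

/-- A solution operator for the homological equation `w = X₀(T w) + ∑ dᵢ(h) aᵢ`, assembled from
the solutions in each degree; it is compatible with the filtrations. -/
lemma exists_solution_operator (hp : ∀ i, 0 < p i) (hδ : 0 < δ)
    (hh : (h : FormalSeries) ∈ homog p δ)
    {μ : ℕ} {a : Fin μ → FormalSeries} {k : Fin μ → ℤ} (ha : ∀ i, a i ∈ homog p (k i))
    (hdec : ∀ g : FormalSeries, ∃ (c : Fin μ → ℂ) (α β : FormalSeries), g = ∑ i, c i • a i +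
      MvPowerSeries.pderiv ℂ 0 (h : FormalSeries) * α +
      MvPowerSeries.pderiv ℂ 1 (h : FormalSeries) * β) :
    ∃ (T : FormalSeries → FormalSeries) (d : FormalSeries → Fin μ → PowerSeries ℂ),
      (∀ w, w = initialField h δ (T w) +
        ∑ i, PowerSeries.subst (h : FormalSeries) (d w i) * a i) ∧
      (∀ (w w' : FormalSeries) (j : ℤ), w - w' ∈ filt p j →
        T w - T w' ∈ filt p (j - ((δ : ℤ) - p 0 - p 1))) ∧
      T 0 = 0 := by
  set k₀ : ℤ := (δ : ℤ) - p 0 - p 1 with hk₀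
  have hs := hasSubst_of_mem_homog hδ hh
  -- the solution must vanish for `g = 0`, so that `T w` has no component of degree `≤ 0` when `w`
  -- has order greater than `δ₀`
  have hex : ∀ (m : ℤ) (g : FormalSeries), ∃ (τ : FormalSeries) (d : Fin μ → PowerSeries ℂ),
      (g = 0 → τ = 0) ∧ (g ∈ homog p m → τ ∈ homog p (m - k₀) ∧
        (∀ i n, PowerSeries.coeff n (d i) ≠ 0 → k i + n * δ = m) ∧
        g = initialField h δ τ + ∑ i, PowerSeries.subst (h : FormalSeries) (d i) * a i) := by
    intro m g
    rcases eq_or_ne g 0 with rfl | hg0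
    · refine ⟨0, 0, fun _ => rfl, fun _ =>
        ⟨Submodule.zero_mem _, fun i n hn => absurd (by simp) hn, ?_⟩⟩
      rw [map_zero, zero_add, Finset.sum_eq_zero]
      intro i _
      rw [Pi.zero_apply, ← PowerSeries.coe_substAlgHom hs, map_zero, zero_mul]
    · by_cases hg : g ∈ homog p m
      · obtain ⟨τ, d, H⟩ := exists_homological hp hδ hh ha hdec m g hg
        exact ⟨τ, d, fun h0 => absurd h0 hg0, fun _ => H⟩
      · exact ⟨0, 0, fun _ => rfl, fun h' => absurd h' hg⟩
  choose t e ht0 hte using hex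
  have ht : ∀ m w, t m (comp p m w) ∈ homog p (m - k₀) := fun m w => (hte m _ (comp_mem m w)).1
  let T : FormalSeries → FormalSeries := fun w q =>
    MvPowerSeries.coeff q (t (wt p q + k₀) (comp p (wt p q + k₀) w))
  have hT : ∀ w q, MvPowerSeries.coeff q (T w) =
    MvPowerSeries.coeff q (t (wt p q + k₀) (comp p (wt p q + k₀) w)) := fun w q => rfl
  have hcompT : ∀ w m, comp p (m - k₀) (T w) = t m (comp p m w) := by
    intro w m
    ext q
    rw [coeff_comp]
    split_ifs with hq
    · rw [hT, show wt p q + k₀ = m by linarith]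
    · exact (ht m w q hq).symm
  refine ⟨T, fun w i => PowerSeries.mk fun n =>
    PowerSeries.coeff n (e (k i + n * δ) (comp p (k i + n * δ) w) i), fun w => ?_, ?_, ?_⟩
  · refine ext_comp (p := p) fun m => ?_
    obtain ⟨-, he, hsol⟩ := hte m _ (comp_mem m w)
    rw [comp_add, comp_initialField hh, hcompT, comp_sum]
    conv_lhs => rw [hsol]
    congr 1
    refine Finset.sum_congr rfl fun i _ => ?_
    rw [mul_comm _ (a i), mul_comm _ (a i), comp_mul _ (ha i), comp_subst hδ hh]
    congr 2
    ext n
    rw [PowerSeries.coeff_mk, PowerSeries.coeff_mk]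
    split_ifs with hn
    · rw [show k i + n * (δ : ℤ) = m by linarith]
    · by_contra hne
      exact hn (by linarith [he i n hne])
  · intro w w' j hj q hq
    rw [map_sub, hT, hT]
    have h0 := comp_eq_zero (show wt p q + k₀ < j by linarith) hj
    rw [comp_sub, sub_eq_zero] at h0
    rw [h0, sub_self]
  · ext q
    have := comp_of_ne (p := p) (j := wt p q + k₀ + 1) (k := wt p q + k₀) (by linarith)
      (Submodule.zero_mem _)
    rw [hT, this, ht0 _ _ rfl]

/-! ### The Jacobian ideal and the fields tangent to the separatrices -/

lemma exists_of_mem_componentIdeal {g : FormalSeries}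
    (hg : g ∈ componentIdeal (initialField h δ)) :
    ∃ α β : FormalSeries, g = MvPowerSeries.pderiv ℂ 0 (h : FormalSeries) * α +
      MvPowerSeries.pderiv ℂ 1 (h : FormalSeries) * β := by
  obtain ⟨c, hc⟩ := (Submodule.mem_span_range_iff_exists_fun FormalSeries).1 hg
  refine ⟨-((δ : ℂ)⁻¹ • c 1), (δ : ℂ)⁻¹ • c 0, ?_⟩
  rw [← hc, Fin.sum_univ_two, initialField_apply, initialField_apply,
    MvPowerSeries.pderiv_X_self, MvPowerSeries.pderiv_X_self,
    MvPowerSeries.pderiv_X_of_ne (by simp : (1 : Fin 2) ≠ 0),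
    MvPowerSeries.pderiv_X_of_ne (by simp : (0 : Fin 2) ≠ 1)]
  simp only [MvPowerSeries.smul_eq_C_mul, smul_eq_mul]
  ring

/-- An ideal of finite codimension contains a power of each variable, since the maximal ideal of
the quotient is nilpotent. -/
lemma exists_X_pow_mem (I : Ideal FormalSeries) [Module.Finite ℂ (FormalSeries ⧸ I)]
    (i : Fin 2) : ∃ N : ℕ, (MvPowerSeries.X i : FormalSeries) ^ N ∈ I := by
  have : IsArtinianRing (FormalSeries ⧸ I) := IsArtinianRing.of_finite ℂ _
  obtain ⟨N, hN⟩ := IsArtinianRing.isNilpotent_jacobson_bot (R := FormalSeries ⧸ I)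
  have hX : Ideal.Quotient.mk I (MvPowerSeries.X i) ∈ (⊥ : Ideal (FormalSeries ⧸ I)).jacobson := by
    rw [Ideal.mem_jacobson_bot]
    intro y
    obtain ⟨y, rfl⟩ := Ideal.Quotient.mk_surjective y
    rw [← map_mul, ← map_one (Ideal.Quotient.mk I), ← map_add]
    refine IsUnit.map _ (MvPowerSeries.isUnit_iff_constantCoeff.2 ?_)
    simp
  refine ⟨N, ?_⟩
  rw [← Ideal.Quotient.eq_zero_iff_mem, map_pow]
  have := Ideal.pow_mem_pow hX N
  rw [hN] at this
  simpa using this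

lemma X_pow_dvd_of_dvd_X_pow_mul {N M : ℕ} {f : FormalSeries}
    (hf : (MvPowerSeries.X 0 : FormalSeries) ^ N ∣ MvPowerSeries.X 1 ^ M * f) :
    (MvPowerSeries.X 0 : FormalSeries) ^ N ∣ f := by
  rw [MvPowerSeries.X_pow_dvd_iff] at hf ⊢
  intro m hm
  have := hf (Finsupp.single 1 M + m) (by simpa using hm)
  rwa [MvPowerSeries.X_pow_eq, MvPowerSeries.coeff_add_monomial_mul, one_mul] at this

/-- If the ideal `(a, b)` contains powers of both variables, then the only relations between `a`
and `b` are the trivial ones. -/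
lemma exists_of_mul_add_mul_eq_zero {a b : FormalSeries} {N M : ℕ}
    {α β α' β' : FormalSeries} (hx : MvPowerSeries.X 0 ^ N = a * α + b * β)
    (hy : MvPowerSeries.X 1 ^ M = a * α' + b * β') {A B : FormalSeries}
    (hAB : A * a + B * b = 0) : ∃ c, A = c * b ∧ B = -(c * a) := by
  have hX0 : (MvPowerSeries.X 0 : FormalSeries) ^ N ≠ 0 :=
    pow_ne_zero _ fun h0 => by
      simpa using congrArg (MvPowerSeries.coeff (Finsupp.single 0 1)) h0
  have h1 : MvPowerSeries.X 0 ^ N * A = b * (β * A - α * B) := by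
    rw [hx]; linear_combination α * hAB
  have h2 : MvPowerSeries.X 0 ^ N * B = -(a * (β * A - α * B)) := by
    rw [hx]; linear_combination β * hAB
  have h3 : MvPowerSeries.X 1 ^ M * A = b * (β' * A - α' * B) := by
    rw [hy]; linear_combination α' * hAB
  have h4 : MvPowerSeries.X 1 ^ M * B = -(a * (β' * A - α' * B)) := by
    rw [hy]; linear_combination β' * hAB
  have h5 : MvPowerSeries.X 1 ^ M * (β * A - α * B) =
      MvPowerSeries.X 0 ^ N * (β' * A - α' * B) := by
    rw [hx]; linear_combination β * h3 - α * h4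
  obtain ⟨c, hc⟩ := X_pow_dvd_of_dvd_X_pow_mul ⟨_, h5⟩
  refine ⟨c, mul_left_cancel₀ hX0 ?_, mul_left_cancel₀ hX0 ?_⟩
  · rw [h1, hc]; ring
  · rw [h2, hc]; ring

lemma isUnit_of_sub_one_mem_filt {u : FormalSeries} (hu : u - 1 ∈ filt p 1) : IsUnit u := by
  rw [MvPowerSeries.isUnit_iff_constantCoeff]
  have h0 := hu 0 (by simp [wt])
  rw [MvPowerSeries.coeff_zero_eq_constantCoeff_apply, map_sub, map_one, sub_eq_zero] at h0
  rw [h0]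
  exact isUnit_one

lemma exists_pderiv_ne_zero (hsing : HasIsolatedSingularity h) :
    ∃ i, MvPowerSeries.pderiv ℂ i (h : FormalSeries) ≠ 0 := by
  obtain ⟨z, i, hz⟩ := hsing.2.exists
  refine ⟨i, fun h0 => hz ?_⟩
  rw [MvPowerSeries.pderiv_coe] at h0
  rw [MvPolynomial.coe_eq_zero_iff.1 h0, map_zero]

/-- A perturbation of `X₀` of higher order that is tangent to `{h = 0}` is a unit times
`X₀ + f R`: subtracting from it the multiple of `R` with the same effect on `h` leaves a field that
kills `h`, hence a multiple of the Hamiltonian field. -/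
lemma exists_logarithmic_form (hδ : 0 < δ)
    (hh : (h : FormalSeries) ∈ homog p δ)
    (hd : ∃ i, MvPowerSeries.pderiv ℂ i (h : FormalSeries) ≠ 0)
    [Module.Finite ℂ (FormalSeries ⧸ componentIdeal (initialField h δ))]
    {V : FormalField}
    (hpert : OrderGT p ((δ : ℤ) - (p 0 : ℤ) - (p 1 : ℤ)) (V - initialField h δ))
    (hlog : IsLogarithmic (h : FormalSeries) V) :
    ∃ u f : FormalSeries, u - 1 ∈ filt p 1 ∧ f ∈ filt p ((δ : ℤ) - p 0 - p 1 + 1) ∧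
      ∀ s, V s = u * (initialField h δ s + f * radial p s) := by
  have hδC : (δ : ℂ) ≠ 0 := by exact_mod_cast hδ.ne'
  set k₀ : ℤ := (δ : ℤ) - p 0 - p 1 with hk₀
  set h₀ := MvPowerSeries.pderiv ℂ 0 (h : FormalSeries) with hh₀
  set h₁ := MvPowerSeries.pderiv ℂ 1 (h : FormalSeries) with hh₁
  have hm₀ : h₀ ∈ homog p (δ - p 0) := pderiv_mem_homog hh 0
  have hm₁ : h₁ ∈ homog p (δ - p 1) := pderiv_mem_homog hh 1
  have hY : ∀ i, V (MvPowerSeries.X i) - initialField h δ (MvPowerSeries.X i) ∈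
      filt p (k₀ + 1 + p i) := by
    intro i m hm
    by_contra hne
    have := hpert i m hne
    rw [wt] at hm
    linarith
  have hX0 : initialField h δ (MvPowerSeries.X 0) = (δ : ℂ)⁻¹ • h₁ := by
    rw [initialField_apply, MvPowerSeries.pderiv_X_self,
      MvPowerSeries.pderiv_X_of_ne (by simp : (0 : Fin 2) ≠ 1), mul_one, mul_zero, sub_zero]
  have hX1 : initialField h δ (MvPowerSeries.X 1) = -((δ : ℂ)⁻¹ • h₀) := by
    rw [initialField_apply, MvPowerSeries.pderiv_X_self,
      MvPowerSeries.pderiv_X_of_ne (by simp : (1 : Fin 2) ≠ 0), mul_one, mul_zero, zero_sub,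
      smul_neg]
  have hh0 : (h : FormalSeries) ≠ 0 := by
    rintro h0
    obtain ⟨i, hi⟩ := hd
    exact hi (by rw [h0, map_zero])
  obtain ⟨g, hg⟩ := Ideal.mem_span_singleton'.1 hlog
  have hVh := field_apply V (h : FormalSeries)
  rw [← hh₀, ← hh₁, ← hg] at hVh
  have hgF : g ∈ filt p (k₀ + 1) := by
    refine mem_filt_of_mul_mem hh hh0 ?_
    have h1 := mul_mem_filt (hY 0) (homog_le_filt hm₀)
    have h2 := mul_mem_filt (hY 1) (homog_le_filt hm₁)
    rw [hX0] at h1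
    rw [hX1] at h2
    have h3 := Submodule.add_mem (filt p (k₀ + 1 + δ)) (filt_anti (by linarith) h1)
      (filt_anti (by linarith) h2)
    convert h3 using 1
    rw [mul_comm, hVh, sub_mul, sub_mul, neg_mul, smul_mul_assoc, smul_mul_assoc, mul_comm h₀ h₁]
    ring
  set G : FormalSeries := (δ : ℂ)⁻¹ • g with hG
  have hGF : G ∈ filt p (k₀ + 1) := Submodule.smul_mem _ _ hgF
  have hGR : G * radial p (h : FormalSeries) = g * h := by
    rw [radial_homog hh, hG, smul_mul_smul_comm, Int.cast_natCast, inv_mul_cancel₀ hδC, one_smul]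
  obtain ⟨N, hN⟩ := exists_X_pow_mem (componentIdeal (initialField h δ)) 0
  obtain ⟨M, hM⟩ := exists_X_pow_mem (componentIdeal (initialField h δ)) 1
  obtain ⟨α, β, hαβ⟩ := exists_of_mem_componentIdeal hN
  obtain ⟨α', β', hαβ'⟩ := exists_of_mem_componentIdeal hM
  have hrel : (V (MvPowerSeries.X 0) - G * ((p 0 : FormalSeries) * MvPowerSeries.X 0)) * h₀ +
      (V (MvPowerSeries.X 1) - G * ((p 1 : FormalSeries) * MvPowerSeries.X 1)) * h₁ = 0 := by
    rw [radial_apply, ← hh₀, ← hh₁] at hGR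
    linear_combination -hVh - hGR
  obtain ⟨c, hc0, hc1⟩ := exists_of_mul_add_mul_eq_zero hαβ hαβ' hrel
  -- `δ c - 1` times `h_x` or `h_y` is known to have large order; divide by a nonzero one
  have hu : (δ : ℂ) • c - 1 ∈ filt p 1 := by
    have hpX : ∀ i, G * ((p i : FormalSeries) * MvPowerSeries.X i) ∈ filt p (k₀ + 1 + p i) := by
      intro i
      rw [← radial_X]
      exact mul_mem_filt hGF (radial_mem_filt (homog_le_filt (X_mem_homog i)))
    have h0 := Submodule.smul_mem _ (δ : ℂ) (Submodule.sub_mem _ (hY 0) (hpX 0))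
    have h1 := Submodule.smul_mem _ (δ : ℂ) (Submodule.sub_mem _ (hY 1) (hpX 1))
    rw [hX0, sub_right_comm, hc0, smul_sub, smul_inv_smul₀ hδC] at h0
    rw [hX1, sub_right_comm, hc1, sub_neg_eq_add, smul_add, smul_neg, smul_inv_smul₀ hδC] at h1
    obtain ⟨i, hi⟩ := hd
    fin_cases i
    · refine mem_filt_of_mul_mem hm₀ hi ?_
      have := Submodule.neg_mem _ (filt_anti (j := 1 + (δ - p 0)) (by linarith) h1)
      convert this using 1
      rw [← smul_mul_assoc]
      ring
    · refine mem_filt_of_mul_mem hm₁ hi ?_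
      have := filt_anti (j := 1 + (δ - p 1)) (by linarith) h0
      convert this using 1
      rw [← smul_mul_assoc]
      ring
  obtain ⟨v, hv⟩ := isUnit_of_sub_one_mem_filt hu
  refine ⟨(δ : ℂ) • c, (↑v⁻¹ : FormalSeries) * G, hu, ?_, ?_⟩
  · exact filt_anti (by linarith)
      (mul_mem_filt (mem_filt_of_nonpos le_rfl (↑v⁻¹ : FormalSeries)) hGF)
  · have hVW : V = ((δ : ℂ) • c) • initialField h δ + G • radial p := by
      refine field_ext fun i => ?_
      fin_cases i
      · simp only [Fin.zero_eta, Derivation.add_apply, Derivation.smul_apply, hX0, radial_X,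
          smul_eq_mul, smul_mul_smul_comm, mul_inv_cancel₀ hδC, one_smul]
        linear_combination hc0
      · simp only [Fin.mk_one, Derivation.add_apply, Derivation.smul_apply, hX1, radial_X,
          smul_eq_mul, mul_neg, smul_mul_smul_comm, mul_inv_cancel₀ hδC, one_smul]
        linear_combination hc1
    intro s
    have hvG : (δ : ℂ) • c * (↑v⁻¹ * G) = G := by
      rw [← hv, Units.mul_inv_cancel_left]
    conv_lhs => rw [hVW]
    simp only [Derivation.add_apply, Derivation.smul_apply, smul_eq_mul]
    rw [mul_add, ← mul_assoc _ (_ * G), hvG]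

lemma exists_decomposition {μ : ℕ} {a : Fin μ → FormalSeries}
    (B : Module.Basis (Fin μ) ℂ (FormalSeries ⧸ componentIdeal (initialField h δ)))
    (hB : ∀ i, B i = Ideal.Quotient.mk (componentIdeal (initialField h δ)) (a i))
    (g : FormalSeries) :
    ∃ (c : Fin μ → ℂ) (α β : FormalSeries), g = ∑ i, c i • a i +
      MvPowerSeries.pderiv ℂ 0 (h : FormalSeries) * α +
      MvPowerSeries.pderiv ℂ 1 (h : FormalSeries) * β := by
  set c := B.repr (Ideal.Quotient.mk _ g) with hc
  have h1 : g - ∑ i, c i • a i ∈ componentIdeal (initialField h δ) := by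
    rw [← Ideal.Quotient.eq_zero_iff_mem, map_sub, sub_eq_zero, map_sum]
    conv_lhs => rw [← B.sum_repr (Ideal.Quotient.mk _ g), ← hc]
    refine Finset.sum_congr rfl fun i _ => ?_
    rw [hB]
    rfl
  obtain ⟨α, β, hαβ⟩ := exists_of_mem_componentIdeal h1
  exact ⟨c, α, β, by rw [add_assoc, ← hαβ, add_sub_cancel]⟩

end QHFoliation

end

theorem mainTheorem1 (p : Fin 2 → ℕ) (hp : ∀ i, 0 < p i) (hcop : Nat.Coprime (p 0) (p 1))
    (h : MvPolynomial (Fin 2) ℂ) (δ : ℕ) (hh : MvPolynomial.IsWeightedHomogeneous p h δ)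
    (hsing : QHFoliation.HasIsolatedSingularity h)
    (μ : ℕ) (a : Fin μ → MvPolynomial (Fin 2) ℂ)
    (ha : ∀ i, ∃ k : ℕ, MvPolynomial.IsWeightedHomogeneous p (a i) k)
    (B : Module.Basis (Fin μ) ℂ (QHFoliation.FormalSeries ⧸
      QHFoliation.componentIdeal (QHFoliation.initialField h δ)))
    (hB : ∀ i, B i = Ideal.Quotient.mk
      (QHFoliation.componentIdeal (QHFoliation.initialField h δ))
      (a i : QHFoliation.FormalSeries))
    (X : QHFoliation.FormalField)
    (hpert : QHFoliation.OrderGT p ((δ : ℤ) - (p 0 : ℤ) - (p 1 : ℤ))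
      (X - QHFoliation.initialField h δ))
    (hlog : QHFoliation.IsLogarithmic (h : QHFoliation.FormalSeries) X) :
    ∃ (d : Fin μ → PowerSeries ℂ) (Φ : QHFoliation.FormalDiffeo) (u : QHFoliation.FormalSeries),
      QHFoliation.IsFibred p Φ ∧ IsUnit u ∧
      QHFoliation.pullback Φ X =
        u • (QHFoliation.initialField h δ +
          ∑ i, (PowerSeries.subst (h : QHFoliation.FormalSeries) (d i) *
            (a i : QHFoliation.FormalSeries)) • QHFoliation.radial p) := by
  open QHFoliation in
  have hH : (h : FormalSeries) ∈ homog p δ := coe_mem_homog hh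
  have hd := exists_pderiv_ne_zero hsing
  have hδ : 0 < δ := by
    obtain ⟨i, hi⟩ := hd
    rw [Nat.pos_iff_ne_zero]
    rintro rfl
    have hpi : (0 : ℤ) < p i := by exact_mod_cast hp i
    exact hi (homog_eq_zero_of_neg (by push_cast; linarith) (pderiv_mem_homog hH i))
  have : Module.Finite ℂ (FormalSeries ⧸ componentIdeal (initialField h δ)) :=
    Module.Finite.of_basis B
  -- `u` is the unit factor of `X`; the unit of the normal form is `Φ(u) A`
  obtain ⟨u, f, hu, hf, hX⟩ := exists_logarithmic_form hδ hH hd hpert hlog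
  choose k hk using ha
  obtain ⟨T, d, hTd, hT, hT0⟩ := exists_solution_operator hp hδ hH
    (fun i => coe_mem_homog (hk i)) (exists_decomposition B hB)
  obtain ⟨A, C, hAC, hdiff, hconj⟩ := exists_conjugation (radial_initialField hH)
    (initialField_mem_filt hH) hf
  set k₀ : ℤ := (δ : ℤ) - p 0 - p 1 with hk₀
  set W := initialField h δ
  have hTmem : ∀ w ∈ filt p (k₀ + 1), T w ∈ filt p 1 := by
    intro w hw
    have := hT w 0 (k₀ + 1) (by rwa [sub_zero])
    rwa [hT0, sub_zero, add_sub_cancel_left] at this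
  have hWmem : ∀ (l : ℤ) (g : FormalSeries), g ∈ filt p l → W g ∈ filt p (l + k₀) :=
    initialField_mem_filt hH
  have hNmem : ∀ (l : ℤ) (w w' : FormalSeries), w - w' ∈ filt p l →
      (w - W (T w)) - (w' - W (T w')) ∈ filt p l := by
    intro l w w' hw
    have h1 := hWmem _ _ (hT w w' l hw)
    rw [sub_add_cancel, map_sub] at h1
    rw [sub_sub_sub_comm]
    exact Submodule.sub_mem _ hw h1
  have hN0 : ∀ w ∈ filt p (k₀ + 1), w - W (T w) ∈ filt p (k₀ + 1) := by
    intro w hw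
    have := hNmem (k₀ + 1) w 0 (by rwa [sub_zero])
    rwa [hT0, map_zero, sub_zero, sub_zero] at this
  -- a fixed point of this map is a `w` such that `C = A (w - X₀(T w))` for `b = T w`
  obtain ⟨w, hw, hfix⟩ := exists_fixedPoint (p := p) (k₀ + 1)
    (fun w => C (T w) + W (T w) - (A (T w) - 1) * (w - W (T w)))
    (by
      intro w hw
      have hb := hTmem w hw
      refine Submodule.sub_mem _ (Submodule.add_mem _ (hAC _ hb).2 ?_) ?_
      · rw [add_comm]
        exact hWmem _ _ hb
      · exact filt_anti (by linarith) (mul_mem_filt (hAC _ hb).1 (hN0 w hw)))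
    (by
      intro w hw w' hw' j hj hww'
      have hb := hTmem w hw
      have hb' := hTmem w' hw'
      have hbb := hT w w' j hww'
      obtain ⟨h1, h2⟩ := hdiff _ hb _ hb' (j - k₀) (by linarith) hbb
      have h3 := filt_anti (j := j + 1) (by linarith) (mul_mem_filt h1 (hN0 w hw))
      have h4 := filt_anti (j := j + 1) (by linarith)
        (mul_mem_filt (hAC _ hb').1 (hNmem j w w' hww'))
      have h5 := filt_anti (j := j + 1) (by linarith) h2
      have h6 := Submodule.sub_mem _ (Submodule.sub_mem _ h5 h3) h4
      convert h6 using 1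
      rw [map_sub]
      ring)
  have hb := hTmem w hw
  have hZ : ∀ l : ℤ, ∀ g ∈ filt p l, (T w • radial p : FormalField) g ∈ filt p (l + 1) := by
    intro l g hg
    rw [add_comm]
    exact mul_mem_filt hb (radial_mem_filt hg)
  obtain ⟨Φ, hΦ⟩ := exists_formalDiffeo_isExpSum hZ
  refine ⟨d w, Φ, Φ u * A (T w), ⟨T w, ?_, IsExpSum.isExp hZ hΦ⟩, ?_, ?_⟩
  · rw [← MvPowerSeries.coeff_zero_eq_constantCoeff_apply]
    exact hb 0 (by simp [wt])
  · exact ((isUnit_of_sub_one_mem_filt hu).map Φ).mul (isUnit_of_sub_one_mem_filt (hAC _ hb).1)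
  · ext1 s
    have h1 : pullback Φ X s = Φ (X (Φ.symm s)) := rfl
    have h2 := hconj _ hb Φ hΦ (Φ.symm s)
    rw [AlgEquiv.apply_symm_apply] at h2
    have h3 := hTd w
    rw [h1, hX, map_mul, h2, ← Finset.sum_smul, Derivation.smul_apply, Derivation.add_apply,
      Derivation.smul_apply, smul_eq_mul, smul_eq_mul]
    linear_combination (Φ u * radial p s) * hfix + (Φ u * A (T w) * radial p s) * h3
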